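/- Let $X$ be a compact connected Riemann surface and $L\to X$ a basepoint-free holomorphic line bundle of positive degree; let $n\ge 1$. Let $(E,\Phi,\omega)$ be an $\mathrm{Sp}_{2n}$-Higgs bundle with $L$-valued form: $E$ is a holomorphic vector bundle of rank $2n$, $\omega:E\otimes E\to L$ is a holomorphic non-degenerate alternating form, and $\Phi:E\to L\otimes E$ is a holomorphic homomorphism with $\omega(\Phi v,w)+\omega(v,\Phi w)=0$. Write $\det(\lambda-\Phi)=\lambda^{2n}+a_2\lambda^{2n-2}+\dots+a_{2n}$ with $a_{2k}\in H^0(X,L^{2k})$ (and $a_0=1$). Assume that $(E,\Phi,\omega)$ is generic: the spectral curve $\{\det(\lambda-\Phi)=0\}\subset\operatorname{Tot}(L)$ is smooth (as a divisor), and $a_{2n-2}$ and $a_{2n}$ have no common zeros. Let $D=(a_{2n})$. A Hecke datum is a family of injective linear maps $i_x:L_x^{-n}\to L_x^{-1}E_x$, $x\in D$, with image $\ker(\Phi_x)$ and with $\omega_x(i_xw,\Phi'_x(i_xw))=-w^2a_{2n}'(x)$ for all $w\in L_x^{-n}$ (derivatives with respect to a local coordinate and local frames at $x$; the condition does not depend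 on them). An $\mathrm{SO}_{2n+1}$-Higgs bundle is a triple $(V,\phi,Q)$ of a holomorphic vector bundle $V$ of rank $2n+1$ with trivial determinant, a holomorphic homomorphism $\phi:V\to L\otimes V$ and a holomorphic non-degenerate symmetric form $Q:V\otimes V\to\mathcal O_X$ with $Q(\phi v,w)+Q(v,\phi w)=0$. It is associated to $(E,\Phi,\omega)$ and defined by $\{i_x\}$ if the sheaf $\mathcal O_X(V)$ is identified with the sheaf of meromorphic sections of $L^{-1}E\oplus L^{-n}$ that are holomorphic away from $D$ and have at most simple poles at the points $x\in D$, with residues in $\Gamma_x=\{(-i_x w,w): w\in L_x^{-n}\}$, in such a way that over $X\setminus D$ one has $\phi(v,w)=(\Phi v,0)$ and $Q((v,w),(v,w))=\omega(v,\Phi v)+w^2a_{2n}$. Suppose that $(V,\phi,Q)$ and $(V',\phi',Q')$ are two $\mathrm{SO}_{2n+1}$-Higgs bundles associated to $(E,\Phi,\omega)$ and defined by the Hecke data $\{i_x\}_{x\in D}$ and $\{i'_x\}_{x\in D}$ respectively. Then $(V,\phi,Q)\cong(V',\phi',Q')$ (there is a holomorphic bundle isomorphism that commutes with the Higgs fields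 and preserves the orthogonal forms) if and only if $i_x=i'_x$ for every $x\in D$, or $i_x=-i'_x$ for every $x\in D$. -/

import Mathlib

open scoped Manifold ContDiff TensorProduct

universe u v v₁ v₂ v₃

section HolomorphicBundles

variable (X : Type u) [TopologicalSpace X] [ChartedSpace ℂ X]

/-- A holomorphic vector bundle of rank `r` over the complex curve `X`. -/
structure HolBundle (r : ℕ) where
  /-- the fibres -/
  Fiber : X → Type v
  [topFiber : ∀ x, TopologicalSpace (Fiber x)]
  [addCommGroup : ∀ x, AddCommGroup (Fiber x)]
  [module : ∀ x, Module ℂ (Fiber x)]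
  [topTotal : TopologicalSpace (Bundle.TotalSpace (Fin r → ℂ) Fiber)]
  [fiberBundle : FiberBundle (Fin r → ℂ) Fiber]
  [vectorBundle : VectorBundle ℂ (Fin r → ℂ) Fiber]
  [holomorphic : ContMDiffVectorBundle ω (Fin r → ℂ) Fiber 𝓘(ℂ)]

attribute [instance] HolBundle.topFiber HolBundle.addCommGroup HolBundle.module
  HolBundle.topTotal HolBundle.fiberBundle HolBundle.vectorBundle HolBundle.holomorphic

variable {X}

/-- The fibres are finite-dimensional. -/
instance HolBundle.finite {r : ℕ} (E : HolBundle.{u, v} X r) (x : X) :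
    Module.Finite ℂ (E.Fiber x) :=
  Module.Finite.equiv ((trivializationAt (Fin r → ℂ) E.Fiber x).continuousLinearEquivAt ℂ x
    (FiberBundle.mem_baseSet_trivializationAt' x)).toLinearEquiv.symm

/-- The function `f` is holomorphic on `U` (used for open `U`). -/
def HolFun (U : Set X) (f : X → ℂ) : Prop :=
  ContMDiffOn 𝓘(ℂ) 𝓘(ℂ) ω f U

/-- The section `s` is holomorphic on `U` (used for open `U`). -/
def HolBundle.HolSection {r : ℕ} (E : HolBundle.{u, v} X r) (U : Set X)
    (s : ∀ x, E.Fiber x) : Prop :=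
  ContMDiffOn 𝓘(ℂ) (𝓘(ℂ).prod 𝓘(ℂ, Fin r → ℂ)) ω
    (fun x => Bundle.TotalSpace.mk' (Fin r → ℂ) x (s x)) U

/-- A fibrewise linear map is a homomorphism of holomorphic vector bundles when it sends
holomorphic local sections to holomorphic local sections. -/
def HolHom {r r' : ℕ} (E : HolBundle.{u, v₁} X r) (E' : HolBundle.{u, v₂} X r')
    (ψ : ∀ x, E.Fiber x →ₗ[ℂ] E'.Fiber x) : Prop :=
  ∀ U : Set X, IsOpen U → ∀ s, E.HolSection U s → E'.HolSection U (fun x => ψ x (s x))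

/-- `ℓ` is a nowhere vanishing holomorphic section of the line bundle `L` on `U`, and `ξ` is
the dual frame of the dual line bundle. -/
def IsLineFrame (L : HolBundle.{u, v} X 1) (U : Set X) (ℓ : ∀ x, L.Fiber x)
    (ξ : ∀ x, Module.Dual ℂ (L.Fiber x)) : Prop :=
  L.HolSection U ℓ ∧ ∀ x ∈ U, ξ x (ℓ x) = 1

/-- `L` is basepoint-free: at every point some global holomorphic section does not vanish. -/
def BasepointFree (L : HolBundle.{u, v} X 1) : Prop :=
  ∀ x, ∃ s, L.HolSection Set.univ s ∧ s x ≠ 0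

/-- The order of vanishing at `x` of a holomorphic section of a line bundle, computed in the
chart of `X` and the trivialisation of `L` around `x`. -/
noncomputable def vanishingOrder (L : HolBundle.{u, v} X 1) (s : ∀ x, L.Fiber x) (x : X) : ℕ :=
  analyticOrderNatAt
    (fun z : ℂ =>
      (trivializationAt (Fin 1 → ℂ) L.Fiber x
        (Bundle.TotalSpace.mk' (Fin 1 → ℂ) ((chartAt ℂ x).symm z)
          (s ((chartAt ℂ x).symm z)))).2 0)
    (chartAt ℂ x x)

/-- `L` has positive degree. The degree of a line bundle with a non-zero global holomorphic
section (such as a basepoint-free one) is the number of zeros of any such section, counted with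
multiplicity. -/
def PositiveDegree (L : HolBundle.{u, v} X 1) : Prop :=
  ∃ s, L.HolSection Set.univ s ∧ (∃ x, s x ≠ 0) ∧ 0 < ∑ᶠ x, vanishingOrder L s x

end HolomorphicBundles

/-- Contraction of a twisted endomorphism `Φ : M → K ⊗ M` with a functional `ξ` on `K`. If `K` is
one-dimensional and `ξ ℓ = 1`, then `Φ v = ℓ ⊗ (contract Φ ξ v)`. -/
noncomputable def contract {K : Type*} {M : Type*} [AddCommGroup K] [Module ℂ K]
    [AddCommGroup M] [Module ℂ M] (Φ : M →ₗ[ℂ] K ⊗[ℂ] M) (ξ : Module.Dual ℂ K) : M →ₗ[ℂ] M :=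
  (TensorProduct.lid ℂ M).toLinearMap ∘ₗ (LinearMap.rTensor M ξ) ∘ₗ Φ

section HiggsBundles

variable {X : Type u} [TopologicalSpace X] [ChartedSpace ℂ X]

/-- The family `Φ x : E x → L x ⊗ E x` is a homomorphism `E → L ⊗ E` of holomorphic bundles:
written in a local frame of `L`, it sends holomorphic sections of `E` to holomorphic ones. -/
def HolTwistedEnd {r : ℕ} (L : HolBundle.{u, v} X 1) (E : HolBundle.{u, v₁} X r)
    (Φ : ∀ x, E.Fiber x →ₗ[ℂ] L.Fiber x ⊗[ℂ] E.Fiber x) : Prop :=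
  ∀ U : Set X, IsOpen U → ∀ ℓ ξ, IsLineFrame L U ℓ ξ → ∀ s, E.HolSection U s →
    E.HolSection U (fun x => contract (Φ x) (ξ x) (s x))

/-- An `L`-twisted `Sp₂ₙ`-Higgs bundle `(E, Φ, ω)` with `L`-valued symplectic form `ω`. -/
structure SpHiggsBundle (L : HolBundle.{u, v} X 1) (n : ℕ) where
  /-- the underlying bundle -/
  E : HolBundle.{u, v₁} X (2 * n)
  /-- the Higgs field `Φ : E → L ⊗ E` -/
  Φ : ∀ x, E.Fiber x →ₗ[ℂ] L.Fiber x ⊗[ℂ] E.Fiber x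
  /-- the symplectic form `E ⊗ E → L` -/
  form : ∀ x, E.Fiber x →ₗ[ℂ] E.Fiber x →ₗ[ℂ] L.Fiber x
  Φ_hol : HolTwistedEnd L E Φ
  form_hol : ∀ U : Set X, IsOpen U → ∀ s t, E.HolSection U s → E.HolSection U t →
    L.HolSection U (fun x => form x (s x) (t x))
  form_alt : ∀ x v, form x v v = 0
  form_nondeg : ∀ x v, (∀ w, form x v w = 0) → v = 0
  /-- `ω(Φ v, w) + ω(v, Φ w) = 0`, an identity in `L x ⊗ L x`, tested on functionals on `L x` -/
  form_compat : ∀ x (ξ : Module.Dual ℂ (L.Fiber x)) v w,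
    form x (contract (Φ x) ξ v) w + form x v (contract (Φ x) ξ w) = 0

/-- An `L`-twisted `SO_m`-Higgs bundle `(V, φ, Q)`. -/
structure SOHiggsBundle (L : HolBundle.{u, v} X 1) (m : ℕ) where
  /-- the underlying bundle -/
  V : HolBundle.{u, v₁} X m
  /-- the Higgs field `φ : V → L ⊗ V` -/
  φ : ∀ x, V.Fiber x →ₗ[ℂ] L.Fiber x ⊗[ℂ] V.Fiber x
  /-- the orthogonal form `V ⊗ V → 𝒪` -/
  Q : ∀ x, V.Fiber x →ₗ[ℂ] V.Fiber x →ₗ[ℂ] ℂ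
  φ_hol : HolTwistedEnd L V φ
  Q_hol : ∀ U : Set X, IsOpen U → ∀ s t, V.HolSection U s → V.HolSection U t →
    HolFun U (fun x => Q x (s x) (t x))
  Q_symm : ∀ x v w, Q x v w = Q x w v
  Q_nondeg : ∀ x v, (∀ w, Q x v w = 0) → v = 0
  Q_compat : ∀ x (ξ : Module.Dual ℂ (L.Fiber x)) v w,
    Q x (contract (φ x) ξ v) w + Q x v (contract (φ x) ξ w) = 0
  /-- `det V` is trivial: its dual has a nowhere vanishing holomorphic section -/
  det_trivial : ∃ vol : ∀ x, (V.Fiber x) [⋀^Fin m]→ₗ[ℂ] ℂ, (∀ x, vol x ≠ 0) ∧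
    ∀ U : Set X, IsOpen U → ∀ s : Fin m → ∀ x, V.Fiber x, (∀ k, V.HolSection U (s k)) →
      HolFun U (fun x => vol x (fun k => s k x))

/-- An isomorphism of `SO_m`-Higgs bundles: a biholomorphic bundle isomorphism that commutes with
the Higgs fields and preserves the orthogonal forms. -/
structure SOHiggsBundle.Iso {L : HolBundle.{u, v} X 1} {m : ℕ}
    (A : SOHiggsBundle.{u, v, v₁} L m) (B : SOHiggsBundle.{u, v, v₂} L m) where
  /-- the isomorphism on fibres -/
  ψ : ∀ x, A.V.Fiber x ≃ₗ[ℂ] B.V.Fiber x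
  ψ_hol : HolHom A.V B.V (fun x => (ψ x).toLinearMap)
  ψ_symm_hol : HolHom B.V A.V (fun x => (ψ x).symm.toLinearMap)
  comm : ∀ x v, (ψ x).toLinearMap.lTensor (L.Fiber x) (A.φ x v) = B.φ x (ψ x v)
  isometry : ∀ x v w, B.Q x (ψ x v) (ψ x w) = A.Q x v w

namespace SpHiggsBundle

variable {L : HolBundle.{u, v} X 1} {n : ℕ}

/-- The characteristic polynomial `det (λ - Φ x)` read through a functional `ξ` on `L x`: for
`ξ ℓ = 1` it satisfies `det (t ℓ - Φ x) = (H.charPoly x ξ).eval t • ℓ ^ (2 n)`. -/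
noncomputable def charPoly (H : SpHiggsBundle.{u, v, v₁} L n) (x : X)
    (ξ : Module.Dual ℂ (L.Fiber x)) : Polynomial ℂ :=
  (contract (H.Φ x) ξ).charpoly

/-- The coefficient `a_k ∈ H⁰(X, L ^ k)` of `λ ^ (2 n - k)` in the characteristic polynomial, paired
with `ξ ^ k`. -/
noncomputable def a (H : SpHiggsBundle.{u, v, v₁} L n) (k : ℕ) (x : X)
    (ξ : Module.Dual ℂ (L.Fiber x)) : ℂ :=
  (H.charPoly x ξ).coeff (2 * n - k)

/-- The set of zeros of the section `a_k` of `L ^ k`. -/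
def zeros (H : SpHiggsBundle.{u, v, v₁} L n) (k : ℕ) : Set X :=
  {x | ∀ ξ : Module.Dual ℂ (L.Fiber x), ξ ≠ 0 → H.a k x ξ = 0}

/-- The divisor `D = (a_{2n})`, as a set of points (its multiplicities are one in the generic case
considered here). -/
def D (H : SpHiggsBundle.{u, v, v₁} L n) : Set X := H.zeros (2 * n)

/-- The spectral curve, the divisor of `det (λ - Φ)` in the total space of `L`, is smooth: at each
of its points one of the two partial derivatives of the local equation is non-zero. -/
def SmoothSpectralCurve (H : SpHiggsBundle.{u, v, v₁} L n) : Prop :=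
  ∀ U : Set X, IsOpen U → ∀ ℓ ξ, IsLineFrame L U ℓ ξ → ∀ x ∈ U, ∀ t : ℂ,
    (H.charPoly x (ξ x)).eval t = 0 →
      (H.charPoly x (ξ x)).derivative.eval t ≠ 0 ∨
      deriv (fun z : ℂ => (H.charPoly ((chartAt ℂ x).symm z)
        (ξ ((chartAt ℂ x).symm z))).eval t) (chartAt ℂ x x) ≠ 0

/-- Genericity: the spectral curve is smooth, and `a_{2n-2}` and `a_{2n}` have no common zero. -/
structure IsGeneric (H : SpHiggsBundle.{u, v, v₁} L n) : Prop where
  smooth : H.SmoothSpectralCurve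
  no_common_zero : ∀ x, ¬ (x ∈ H.zeros (2 * n - 2) ∧ x ∈ H.zeros (2 * n))

/-- The fibre at `x` of `L⁻¹ E`. -/
abbrev TwistFiber (H : SpHiggsBundle.{u, v, v₁} L n) (x : X) : Type (max v v₁) :=
  L.Fiber x →ₗ[ℂ] H.E.Fiber x

/-- The fibre at `x` of `L ^ (-n)`: the `n`-linear forms on the line `L x`. -/
abbrev NegPowFiber (_H : SpHiggsBundle.{u, v, v₁} L n) (x : X) : Type v :=
  MultilinearMap ℂ (fun _ : Fin n => L.Fiber x) ℂ

/-- The fibre at `x` of `L⁻¹ E ⊕ L ^ (-n)`. -/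
abbrev ModelFiber (H : SpHiggsBundle.{u, v, v₁} L n) (x : X) : Type (max v v₁) :=
  H.TwistFiber x × H.NegPowFiber x

/-- A family of linear maps `i_x : L_x ^ (-n) → L_x⁻¹ E_x`, `x ∈ D`. -/
abbrev HeckeFamily (H : SpHiggsBundle.{u, v, v₁} L n) : Type (max u v v₁) :=
  ∀ x : H.D, H.NegPowFiber (x : X) →ₗ[ℂ] H.TwistFiber (x : X)

/-- The family `i` is a Hecke datum: each `i_x` is injective with image `ker Φ_x`, and satisfies
`ω_x(i_x w, Φ'_x (i_x w)) = - w ^ 2 a_{2n}'(x)`. -/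
structure IsHeckeDatum (H : SpHiggsBundle.{u, v, v₁} L n) (i : H.HeckeFamily) : Prop where
  injective : ∀ x : H.D, Function.Injective (i x)
  range_eq : ∀ x : H.D, ∀ α : H.TwistFiber (x : X),
    α ∈ LinearMap.range (i x) ↔ ∀ ξ : Module.Dual ℂ (L.Fiber x), contract (H.Φ x) ξ ∘ₗ α = 0
  /-- In a local frame `ℓ` of `L` and with `e` a holomorphic section of `E` that extends the vector
  `i_x w`. As `Φ_x` kills `i_x w` and `ω(·, Φ ·)` is symmetric, the derivative of `ω(e, Φ e)` at `x`
  is `ω_x(i_x w, Φ'_x (i_x w))`, whatever the extension and the frames. -/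
  normalized : ∀ (x : H.D) (w : H.NegPowFiber x) (U : Set X), IsOpen U → (x : X) ∈ U →
    ∀ ℓ ξ, IsLineFrame L U ℓ ξ → ∀ e, H.E.HolSection U e → e x = i x w (ℓ x) →
      deriv (fun z : ℂ =>
        (fun y => ξ y (H.form y (e y) (contract (H.Φ y) (ξ y) (e y))))
          ((chartAt ℂ (x : X)).symm z)) (chartAt ℂ (x : X) x) =
      - (w fun _ => ℓ x) ^ 2 *
        deriv (fun z : ℂ => (fun y => H.a (2 * n) y (ξ y)) ((chartAt ℂ (x : X)).symm z))
          (chartAt ℂ (x : X) x)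

/-- The sections over `U` of the Hecke modification of `L⁻¹ E ⊕ L ^ (-n)` defined by `i`: they are
holomorphic on `U \ D`, and at each `x ∈ U ∩ D` they have at most a simple pole, with residue in
`Γ_x = {(-i_x w, w)}`. The values of `t` on `D` play no role. Sections of `L⁻¹ E` and `L ^ (-n)`
are written in local frames `ℓ` of `L`, as sections of `E` and as functions. -/
structure IsHeckeSection (H : SpHiggsBundle.{u, v, v₁} L n) (i : H.HeckeFamily) (U : Set X)
    (t : ∀ x, H.ModelFiber x) : Prop where
  hol : ∀ W : Set X, IsOpen W → W ⊆ U \ H.D → ∀ ℓ ξ, IsLineFrame L W ℓ ξ →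
    H.E.HolSection W (fun y => (t y).1 (ℓ y)) ∧ HolFun W (fun y => (t y).2 fun _ => ℓ y)
  /-- near `x` one has `t = (e, b) / z` for the coordinate `z` centred at `x`, where `e` and `b` are
  holomorphic and `(e x, b x)` is in `Γ_x` -/
  pole : ∀ x : H.D, ∀ W : Set X, IsOpen W → W ⊆ U → (x : X) ∈ W → ∀ ℓ ξ, IsLineFrame L W ℓ ξ →
    ∃ W' : Set X, IsOpen W' ∧ (x : X) ∈ W' ∧ W' ⊆ W ∧ W' ⊆ (chartAt ℂ (x : X)).source ∧
      ∃ (e : ∀ y, H.E.Fiber y) (b : X → ℂ) (w : H.NegPowFiber x),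
        H.E.HolSection W' e ∧ HolFun W' b ∧
        e x = -(i x w (ℓ x)) ∧ (b x = w fun _ => ℓ x) ∧
        ∀ y ∈ W' \ H.D,
          e y = (chartAt ℂ (x : X) y - chartAt ℂ (x : X) x) • (t y).1 (ℓ y) ∧
          b y = (chartAt ℂ (x : X) y - chartAt ℂ (x : X) x) * (t y).2 fun _ => ℓ y

/-- `(V, φ, Q)` is an `SO_{2n+1}`-Higgs bundle associated to `(E, Φ, ω)` and defined by `i`: the
sheaf of sections of `V` is identified with the Hecke modification defined by `i`, so that, away
from `D`, the field `φ` becomes `(v, w) ↦ (Φ v, 0)` and the form `Q` the polarisation of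
`(v, w) ↦ ω(v, Φ v) + w ^ 2 a_{2n}`. -/
def IsAssociated (H : SpHiggsBundle.{u, v, v₁} L n) (i : H.HeckeFamily)
    (A : SOHiggsBundle.{u, v, v₂} L (2 * n + 1)) : Prop :=
  ∃ T : ∀ x, A.V.Fiber x →ₗ[ℂ] H.ModelFiber x,
    (∀ x ∉ H.D, Function.Bijective (T x)) ∧
    (∀ U : Set X, IsOpen U → ∀ s, A.V.HolSection U s → H.IsHeckeSection i U (fun x => T x (s x))) ∧
    (∀ U : Set X, IsOpen U → ∀ t, H.IsHeckeSection i U t →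
      ∃ s, A.V.HolSection U s ∧ ∀ x ∈ U \ H.D, T x (s x) = t x) ∧
    (∀ x ∉ H.D, ∀ (ξ : Module.Dual ℂ (L.Fiber x)) (v : A.V.Fiber x),
      T x (contract (A.φ x) ξ v) = (contract (H.Φ x) ξ ∘ₗ (T x v).1, 0)) ∧
    (∀ x ∉ H.D, ∀ (ℓ : L.Fiber x) (ξ : Module.Dual ℂ (L.Fiber x)), ξ ℓ = 1 →
      ∀ v : A.V.Fiber x,
        A.Q x v v = ξ (H.form x ((T x v).1 ℓ) (contract (H.Φ x) ξ ((T x v).1 ℓ))) +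
          ((T x v).2 fun _ => ℓ) ^ 2 * H.a (2 * n) x ξ)

end SpHiggsBundle

end HiggsBundles

/-! Off `D` the field `Φ` is invertible, so `L⁻¹E` and `L⁻ⁿ` are the image and the kernel of `(Φ,
0)`. An isomorphism of the two Higgs bundles therefore becomes, off `D`, a pair `(f, c)`: an
endomorphism `f` of `E` commuting with `Φ`, and a nowhere zero function `c`
(`exists_blocks_of_bijective`, `exists_carriesHecke_of_iso`). This pair carries one Hecke
modification into the other; testing it on suitable sections shows that `f` and `c` extend
holomorphically over `D`. On a compact connected curve `c` is then a constant `C`.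

Smoothness of the spectral curve makes every `Φ_x` regular, also over `D` (`exists_cyclic`), so
locally `f = ∑ g_k Φ^k` with holomorphic `g_k`. These glue to sections of `L⁻ᵏ`. For a global
section `s` of `L` the function `g_k s^k` is constant, and for `k ≥ 1` it is zero as soon as `s` has
a zero; at any given point some such `s` does not vanish. Hence `f` is a constant scalar `μ`
(`CarriesHecke.exists_const`).

Comparing residues at `x ∈ D` gives `C i'_x = μ i_x`. Both data satisfy the same quadratic
normalisation and `a_{2n}` has simple zeros, so `(μ / C)² = 1`. The ratio does not depend on `x`,
whence one sign for all of `D` (`CarriesHecke.eq_or_eq_neg`).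

Conversely, if `i' = κ i` with `κ = ±1`, the map `(v, w) ↦ (κ v, w)` matches the residue conditions,
commutes with `(Φ, 0)` and preserves the form, which is quadratic in `v`. Everything extends over
`D` because its complement is dense (`nonempty_iso_of_eq_smul`). -/

/-! ### Holomorphic functions, sections and local frames. -/

section HolomorphicCalculus

variable {X : Type u} [TopologicalSpace X] [ChartedSpace ℂ X]

namespace HolFun

variable {U W : Set X} {f g : X → ℂ}

lemma const (c : ℂ) : HolFun U (fun _ : X => c) := contMDiffOn_const

lemma mono (h : HolFun U f) (hW : W ⊆ U) : HolFun W f := ContMDiffOn.mono h hW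

lemma congr (h : HolFun U f) (hfg : ∀ x ∈ U, g x = f x) : HolFun U g := ContMDiffOn.congr h hfg

lemma add (hf : HolFun U f) (hg : HolFun U g) : HolFun U (fun x => f x + g x) :=
  ContMDiffOn.add hf hg

lemma mul (hf : HolFun U f) (hg : HolFun U g) : HolFun U (fun x => f x * g x) :=
  ContMDiffOn.mul hf hg

lemma pow (hf : HolFun U f) (k : ℕ) : HolFun U (fun x => f x ^ k) :=
  ContMDiffOn.pow hf k

lemma sum {ι : Type*} {s : Finset ι} {F : ι → X → ℂ} (h : ∀ i ∈ s, HolFun U (F i)) :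
    HolFun U (fun x => ∑ i ∈ s, F i x) :=
  contMDiffOn_finsetSum h

lemma prod {ι : Type*} {s : Finset ι} {F : ι → X → ℂ} (h : ∀ i ∈ s, HolFun U (F i)) :
    HolFun U (fun x => ∏ i ∈ s, F i x) :=
  contMDiffOn_finsetProd h

lemma inv (hf : HolFun U f) (h0 : ∀ x ∈ U, f x ≠ 0) : HolFun U (fun x => (f x)⁻¹) :=
  fun x hx => ((contDiffAt_inv ℂ (h0 x hx)).contMDiffAt).comp_contMDiffWithinAt x (hf x hx)

lemma continuousOn (hf : HolFun U f) : ContinuousOn f U := ContMDiffOn.continuousOn hf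

lemma of_locally (h : ∀ x ∈ U, ∃ W, IsOpen W ∧ x ∈ W ∧ HolFun (U ∩ W) f) : HolFun U f :=
  contMDiffOn_of_locally_contMDiffOn h

lemma det {ι : Type*} [Fintype ι] [DecidableEq ι] {M : X → Matrix ι ι ℂ}
    (h : ∀ i j, HolFun U (fun x => M x i j)) : HolFun U (fun x => (M x).det) := by
  simp only [Matrix.det_apply']
  exact sum fun σ _ => (const _).mul (prod fun i _ => h _ _)

lemma matrix_inv {ι : Type*} [Fintype ι] [DecidableEq ι] {M : X → Matrix ι ι ℂ}
    (h : ∀ i j, HolFun U (fun x => M x i j)) (h0 : ∀ x ∈ U, (M x).det ≠ 0) (i j : ι) :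
    HolFun U (fun x => (M x)⁻¹ i j) := by
  simp only [Matrix.inv_def, Matrix.smul_apply, Ring.inverse_eq_inv', smul_eq_mul,
    Matrix.adjugate_apply]
  refine ((det h).inv h0).mul (det fun k l => ?_)
  by_cases hk : k = j
  · subst hk
    simpa using const _
  · simpa [Matrix.updateRow_ne hk] using h k l

end HolFun

namespace HolBundle

variable {r : ℕ} {E : HolBundle.{u, v} X r} {U W : Set X} {s t : ∀ x, E.Fiber x}

lemma HolSection.mono (h : E.HolSection U s) (hW : W ⊆ U) : E.HolSection W s :=
  ContMDiffOn.mono h hW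

lemma HolSection.congr (h : E.HolSection U s) (hst : ∀ x ∈ U, t x = s x) : E.HolSection U t :=
  ContMDiffOn.congr h fun x hx => by rw [hst x hx]

lemma HolSection.smul {f : X → ℂ} (hf : HolFun U f) (h : E.HolSection U s) :
    E.HolSection U (fun x => f x • s x) :=
  ContMDiffOn.smul_section hf h

lemma HolSection.sum {ι : Type*} {S : Finset ι} {F : ι → ∀ x, E.Fiber x}
    (h : ∀ i ∈ S, E.HolSection U (F i)) : E.HolSection U (fun x => ∑ i ∈ S, F i x) :=
  ContMDiffOn.sum_section h

lemma HolSection.of_locally (h : ∀ x ∈ U, ∃ W, IsOpen W ∧ x ∈ W ∧ E.HolSection (U ∩ W) s) :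
    E.HolSection U s :=
  contMDiffOn_of_locally_contMDiffOn h

/-- `s` is a holomorphic frame of `E` over `U` with coordinate functionals `κ`. -/
structure IsFrame (E : HolBundle.{u, v} X r) (U : Set X) (s : Fin r → ∀ x, E.Fiber x)
    (κ : Fin r → ∀ x, Module.Dual ℂ (E.Fiber x)) : Prop where
  hol : ∀ j, E.HolSection U (s j)
  coord_hol : ∀ W ⊆ U, IsOpen W → ∀ t, E.HolSection W t → ∀ j, HolFun W (fun y => κ j y (t y))
  sum_eq : ∀ y ∈ U, ∀ v, ∑ j, κ j y v • s j y = v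
  coord_frame : ∀ y ∈ U, ∀ j k, κ j y (s k y) = if j = k then 1 else 0

lemma exists_isFrame (E : HolBundle.{u, v} X r) (x : X) :
    ∃ U, IsOpen U ∧ x ∈ U ∧ ∃ s κ, E.IsFrame U s κ := by
  have : ContMDiffVectorBundle 1 (Fin r → ℂ) E.Fiber 𝓘(ℂ) :=
    ContMDiffVectorBundle.of_le (n := ω) le_top
  let e := trivializationAt (Fin r → ℂ) E.Fiber x
  let b := Pi.basisFun ℂ (Fin r)
  refine ⟨e.baseSet, e.open_baseSet, FiberBundle.mem_baseSet_trivializationAt' x,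
    e.localFrame b, e.localFrameCoeff 𝓘(ℂ) b, ?_, ?_, ?_, ?_⟩
  · intro j
    exact e.contMDiffOn_localFrame_baseSet ω b j
  · intro W hW hWo t ht j
    exact contMDiffOn_localFrameCoeff b hWo hW ht j
  · classical
    intro y hy v
    -- The expansion formula is about sections, so `v` is extended by zero; no continuity is needed.
    have := e.eq_sum_localFrameCoeff_smul (I := 𝓘(ℂ)) (b := b) (x' := y)
      (s := Function.update (fun _ => 0) y v) hy
    simpa using this.symm
  · intro y hy j k
    rw [e.localFrameCoeff_apply_of_mem_baseSet b hy (e.localFrame b k), e.localFrame_apply_of_mem_baseSet b hy,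
      Module.Basis.repr_self, Finsupp.single_apply]
    simp [eq_comm]

namespace IsFrame

variable {e : Fin r → ∀ x, E.Fiber x} {κ : Fin r → ∀ x, Module.Dual ℂ (E.Fiber x)}

lemma mono (h : E.IsFrame U e κ) (hW : W ⊆ U) : E.IsFrame W e κ where
  hol j := (h.hol j).mono hW
  coord_hol V hV := h.coord_hol V (hV.trans hW)
  sum_eq y hy := h.sum_eq y (hW hy)
  coord_frame y hy := h.coord_frame y (hW hy)

/-- The basis of a fibre given by a frame. -/
noncomputable def basis (h : E.IsFrame U e κ) {y : X} (hy : y ∈ U) :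
    Module.Basis (Fin r) ℂ (E.Fiber y) :=
  .ofEquivFun
    { toFun := fun v j => κ j y v
      map_add' := fun v w => by ext; simp
      map_smul' := fun c v => by ext; simp
      invFun := fun c => ∑ j, c j • e j y
      left_inv := fun v => h.sum_eq y hy v
      right_inv := fun c => by ext j; simp [h.coord_frame y hy] }

lemma basis_repr (h : E.IsFrame U e κ) {y : X} (hy : y ∈ U) (v : E.Fiber y) (j : Fin r) :
    (h.basis hy).repr v j = κ j y v := by
  change (h.basis hy).equivFun v j = κ j y v
  simp [basis]

lemma basis_apply (h : E.IsFrame U e κ) {y : X} (hy : y ∈ U) (j : Fin r) :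
    h.basis hy j = e j y := by
  refine (h.basis hy).repr.injective ?_
  ext k
  rw [basis_repr, basis_repr, ← basis_repr h hy, Module.Basis.repr_self,
    h.coord_frame y hy, Finsupp.single_apply]
  simp [eq_comm]

end IsFrame

lemma finrank_fiber (E : HolBundle.{u, v} X r) (x : X) : Module.finrank ℂ (E.Fiber x) = r := by
  obtain ⟨U, -, hx, s, κ, h⟩ := E.exists_isFrame x
  simpa using Module.finrank_eq_card_basis (h.basis hx)

lemma exists_holSection_eq (E : HolBundle.{u, v} X r) (x : X) (v : E.Fiber x) :
    ∃ U, IsOpen U ∧ x ∈ U ∧ ∃ s, E.HolSection U s ∧ s x = v := by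
  obtain ⟨U, hU, hx, s, κ, h⟩ := E.exists_isFrame x
  exact ⟨U, hU, hx, fun y => ∑ j, κ j x v • s j y,
    HolSection.sum fun j _ => HolSection.smul (HolFun.const _) (h.hol j), h.sum_eq x hx v⟩

/-- Holomorphic sections that are linearly independent at a point form a frame nearby. -/
lemma exists_isFrame_of_linearIndependent (hU : IsOpen U) {x : X} (hx : x ∈ U)
    {t : Fin r → ∀ x, E.Fiber x} (ht : ∀ j, E.HolSection U (t j))
    (hli : LinearIndependent ℂ (fun j => t j x)) :
    ∃ W ⊆ U, IsOpen W ∧ x ∈ W ∧ ∃ κ, E.IsFrame W t κ := by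
  obtain ⟨U', hU', hx', s, κ, h⟩ := E.exists_isFrame x
  let M : X → Matrix (Fin r) (Fin r) ℂ := fun y => .of fun j k => κ j y (t k y)
  have hM : ∀ i j, HolFun (U ∩ U') (fun y => M y i j) := fun i j =>
    h.coord_hol _ Set.inter_subset_right (hU.inter hU') _ ((ht j).mono Set.inter_subset_left) i
  have hdet : HolFun (U ∩ U') (fun y => (M y).det) := HolFun.det hM
  have hdet0 : (M x).det ≠ 0 := by
    have : M x = (h.basis hx').toMatrix (fun j => t j x) := by
      ext i j
      rw [Module.Basis.toMatrix_apply, IsFrame.basis_repr]; rfl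
    rw [this, ← Module.Basis.det_apply, ← isUnit_iff_ne_zero, ← Module.Basis.is_basis_iff_det]
    exact ⟨hli, hli.span_eq_top_of_card_eq_finrank' (by simp [E.finrank_fiber])⟩
  let W := (U ∩ U') ∩ (fun y => (M y).det) ⁻¹' {0}ᶜ
  have hW : IsOpen W :=
    hdet.continuousOn.isOpen_inter_preimage (hU.inter hU') isOpen_compl_singleton
  have hWd : ∀ y ∈ W, (M y).det ≠ 0 := fun y hy => hy.2
  have hWU' : W ⊆ U' := fun y hy => hy.1.2
  -- The columns of `M` are the coordinates of the `t k` in the frame `s`, so `M⁻¹` turns old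
  -- coordinates into new ones.
  refine ⟨W, fun y hy => hy.1.1, hW, ⟨⟨hx, hx'⟩, hdet0⟩,
    fun k y => ∑ j, (M y)⁻¹ k j • κ j y, ?_, ?_, ?_, ?_⟩
  · exact fun j => (ht j).mono fun y hy => hy.1.1
  · intro V hV hVo τ hτ k
    simp only [LinearMap.sum_apply, LinearMap.smul_apply, smul_eq_mul]
    refine HolFun.sum fun j _ => HolFun.mul ?_ (h.coord_hol V (hV.trans hWU') hVo τ hτ j)
    exact HolFun.matrix_inv (fun i j => (hM i j).mono fun y hy => (hV hy).1)
      (fun y hy => hWd y (hV hy)) k j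
  · classical
    intro y hy v
    refine (h.basis (hWU' hy)).repr.injective ?_
    ext i
    rw [IsFrame.basis_repr, IsFrame.basis_repr, map_sum]
    have hinv : M y * (M y)⁻¹ = 1 :=
      Matrix.mul_nonsing_inv _ (isUnit_iff_ne_zero.mpr (hWd y hy))
    have : ∀ k, κ i y ((∑ j, (M y)⁻¹ k j • κ j y) v • t k y) =
        ∑ j, M y i k * (M y)⁻¹ k j * κ j y v := by
      intro k
      simp only [map_smul, LinearMap.sum_apply, LinearMap.smul_apply, smul_eq_mul,
        Finset.sum_mul, M, Matrix.of_apply]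
      exact Finset.sum_congr rfl fun j _ => by ring
    simp only [this]
    rw [Finset.sum_comm]
    simp only [← Finset.sum_mul, ← Matrix.mul_apply, hinv]
    simp [Matrix.one_apply]
  · intro y hy j k
    have hinv : (M y)⁻¹ * M y = 1 :=
      Matrix.nonsing_inv_mul _ (isUnit_iff_ne_zero.mpr (hWd y hy))
    rw [← Matrix.one_apply, ← hinv, Matrix.mul_apply]
    simp [M]

end HolBundle

section LineFrames

variable {L : HolBundle.{u, v} X 1} {U W : Set X} {ℓ : ∀ x, L.Fiber x}
  {ξ : ∀ x, Module.Dual ℂ (L.Fiber x)}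

lemma exists_isLineFrame (L : HolBundle.{u, v} X 1) (x : X) :
    ∃ U, IsOpen U ∧ x ∈ U ∧ ∃ ℓ ξ, IsLineFrame L U ℓ ξ := by
  obtain ⟨U, hU, hx, s, κ, h⟩ := L.exists_isFrame x
  exact ⟨U, hU, hx, s 0, κ 0, h.hol 0, fun y hy => by simp [h.coord_frame y hy]⟩

lemma IsLineFrame.mono (h : IsLineFrame L U ℓ ξ) (hW : W ⊆ U) : IsLineFrame L W ℓ ξ :=
  ⟨h.1.mono hW, fun x hx => h.2 x (hW hx)⟩

lemma eq_smul_of_dual_eq_one {K : Type*} [AddCommGroup K] [Module ℂ K]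
    (hK : Module.finrank ℂ K = 1) {ℓ : K} {ξ : Module.Dual ℂ K} (h : ξ ℓ = 1) (v : K) :
    v = ξ v • ℓ := by
  have hℓ : ℓ ≠ 0 := by rintro rfl; simp at h
  obtain ⟨c, rfl⟩ := (finrank_eq_one_iff_of_nonzero' ℓ hℓ).mp hK v
  simp [h]

lemma IsLineFrame.eq_smul (h : IsLineFrame L U ℓ ξ) {y : X} (hy : y ∈ U) (v : L.Fiber y) :
    v = ξ y v • ℓ y :=
  eq_smul_of_dual_eq_one (L.finrank_fiber y) (h.2 y hy) v

lemma IsLineFrame.ne_zero (h : IsLineFrame L U ℓ ξ) {y : X} (hy : y ∈ U) : ℓ y ≠ 0 := by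
  intro h0
  have := h.2 y hy
  simp [h0] at this

lemma IsLineFrame.dual_ne_zero (h : IsLineFrame L U ℓ ξ) {y : X} (hy : y ∈ U) : ξ y ≠ 0 := by
  intro h0
  have := h.2 y hy
  simp [h0] at this

/-- `IsLineFrame` asks only `ℓ` to be holomorphic. The dual frame is then holomorphic too, since
`ξ(s) = κ(s) / κ(ℓ)` for the coordinate `κ` of any holomorphic frame. -/
lemma IsLineFrame.holFun (h : IsLineFrame L U ℓ ξ) (hWU : W ⊆ U) (hW : IsOpen W)
    {s : ∀ x, L.Fiber x} (hs : L.HolSection W s) : HolFun W (fun y => ξ y (s y)) := by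
  refine HolFun.of_locally fun x hx => ?_
  obtain ⟨V, hV, hxV, e, κ, hf⟩ := L.exists_isFrame x
  refine ⟨V, hV, hxV, ?_⟩
  have h1 := hf.coord_hol _ Set.inter_subset_right (hW.inter hV) s (hs.mono Set.inter_subset_left) 0
  have h2 := hf.coord_hol _ Set.inter_subset_right (hW.inter hV) ℓ
    (h.1.mono (Set.inter_subset_left.trans hWU)) 0
  have key : ∀ y ∈ W ∩ V, ∀ v, κ 0 y v = ξ y v * κ 0 y (ℓ y) := fun y hy v => by
    conv_lhs => rw [h.eq_smul (hWU hy.1) v]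
    simp
  have h0 : ∀ y ∈ W ∩ V, κ 0 y (ℓ y) ≠ 0 := fun y hy h0 => by
    have := key y hy (e 0 y)
    simp [h0, hf.coord_frame y hy.2] at this
  refine (h1.mul (h2.inv h0)).congr fun y hy => ?_
  rw [key y hy, mul_assoc, mul_inv_cancel₀ (h0 y hy), mul_one]

end LineFrames

end HolomorphicCalculus

/-! ### Determinants of corank two, cyclic vectors and infinitesimally symplectic maps. -/

section LinearAlgebra

/-- Every Leibniz term contains an entry of row `i` and one of row `j`; after differentiating one
factor, a vanishing factor remains. -/
lemma deriv_det_eq_zero_of_rows {ι : Type*} [Fintype ι] [DecidableEq ι] {M : ℂ → Matrix ι ι ℂ}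
    {z₀ : ℂ} (hM : ∀ k l, DifferentiableAt ℂ (fun z => M z k l) z₀) {i j : ι} (hij : i ≠ j)
    (hi : M z₀ i = 0) (hj : M z₀ j = 0) : deriv (fun z => (M z).det) z₀ = 0 := by
  have key : ∀ σ : Equiv.Perm ι,
      HasDerivAt (fun z => ∏ k, (M z).transpose (σ k) k) 0 z₀ := by
    intro σ
    have := HasDerivAt.fun_finsetProd (u := Finset.univ) (x := z₀)
      (f := fun k z => (M z).transpose (σ k) k)
      (fun k _ => (hM k (σ k)).hasDerivAt)
    refine this.congr_deriv (Finset.sum_eq_zero fun k _ => ?_)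
    rw [smul_eq_mul]
    refine mul_eq_zero_of_left ?_ _
    by_cases hk : k = i
    · refine Finset.prod_eq_zero (i := j) (by simp [hk, hij.symm]) ?_
      simp [hj]
    · refine Finset.prod_eq_zero (i := i) (by simp [Ne.symm hk]) ?_
      simp [hi]
  have h2 : HasDerivAt (fun z => ∑ σ : Equiv.Perm ι,
      (Equiv.Perm.sign σ : ℂ) * ∏ k, (M z).transpose (σ k) k) (∑ σ : Equiv.Perm ι,
        (Equiv.Perm.sign σ : ℂ) * 0) z₀ :=
    HasDerivAt.fun_sum fun σ _ => (key σ).const_mul _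
  simp only [mul_zero, Finset.sum_const_zero] at h2
  refine (h2.congr_of_eventuallyEq (Filter.Eventually.of_forall fun z => ?_)).deriv
  simp only
  rw [← Matrix.det_transpose, Matrix.det_apply']

lemma Matrix.det_updateRow_vecMul {ι : Type*} [Fintype ι] [DecidableEq ι] (M : Matrix ι ι ℂ)
    (i : ι) (c : ι → ℂ) : (M.updateRow i (Matrix.vecMul c M)).det = c i * M.det := by
  have : Matrix.vecMul c M = ∑ k, c k • M k := by
    ext l
    simp [Matrix.vecMul, dotProduct]
  rw [this, Matrix.det_updateRow_sum]
  rfl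

/-- A determinant vanishes to second order where the corank is at least two: row operations with
constant coefficients produce two rows that vanish at `z₀`, and change the determinant by a non-zero
constant. -/
lemma deriv_det_eq_zero {ι : Type*} [Fintype ι] [DecidableEq ι] {M : ℂ → Matrix ι ι ℂ}
    {z₀ : ℂ} (hM : ∀ k l, DifferentiableAt ℂ (fun z => M z k l) z₀) {a b : ι → ℂ}
    (hab : LinearIndependent ℂ ![a, b]) (ha : Matrix.vecMul a (M z₀) = 0)
    (hb : Matrix.vecMul b (M z₀) = 0) : deriv (fun z => (M z).det) z₀ = 0 := by
  have ha0 : a ≠ 0 := hab.ne_zero 0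
  obtain ⟨i, hi⟩ := Function.ne_iff.mp ha0
  simp only [Pi.zero_apply] at hi
  -- As `c i = 0`, the combination `c · M` does not involve row `i`, so the two row replacements do
  -- not interfere.
  let c : ι → ℂ := b - (b i / a i) • a
  have hci : c i = 0 := by simp [c, hi]
  have hc0 : c ≠ 0 := by
    intro h0
    have := (LinearIndependent.pair_iff.mp hab) (-(b i / a i)) 1 (by
      rw [← h0]; simp only [c]; module)
    exact one_ne_zero this.2
  obtain ⟨j, hj⟩ := Function.ne_iff.mp hc0
  simp only [Pi.zero_apply] at hj
  have hij : i ≠ j := by rintro rfl; exact hj hci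
  have hcM : Matrix.vecMul c (M z₀) = 0 := by
    simp [c, Matrix.sub_vecMul, Matrix.smul_vecMul, ha, hb]
  let N : ℂ → Matrix ι ι ℂ := fun z =>
    ((M z).updateRow i (Matrix.vecMul a (M z))).updateRow j (Matrix.vecMul c (M z))
  have hvm : ∀ (d : ι → ℂ) l, DifferentiableAt ℂ (fun z => Matrix.vecMul d (M z) l) z₀ := by
    intro d l
    simp only [Matrix.vecMul, dotProduct]
    exact DifferentiableAt.fun_sum fun k _ => (hM k l).const_mul _
  have hN : ∀ k l, DifferentiableAt ℂ (fun z => N z k l) z₀ := by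
    intro k l
    by_cases hkj : k = j
    · subst hkj
      simpa [N] using hvm c l
    · by_cases hki : k = i
      · subst hki
        simpa [N, Matrix.updateRow_ne hkj] using hvm a l
      · simpa [N, Matrix.updateRow_ne hkj, Matrix.updateRow_ne hki] using hM k l
  have hdet : ∀ z, (N z).det = c j * a i * (M z).det := by
    intro z
    have hc : Matrix.vecMul c (M z) =
        Matrix.vecMul c ((M z).updateRow i (Matrix.vecMul a (M z))) := by
      ext l
      simp only [Matrix.vecMul, dotProduct]
      refine Finset.sum_congr rfl fun k _ => ?_
      by_cases hki : k = i
      · simp [hki, hci]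
      · simp [Matrix.updateRow_ne hki]
    simp only [N]
    rw [hc, Matrix.det_updateRow_vecMul, Matrix.det_updateRow_vecMul, mul_assoc]
  have h0 : deriv (fun z => (N z).det) z₀ = 0 := by
    refine deriv_det_eq_zero_of_rows hN hij ?_ ?_
    · simp [N, Matrix.updateRow_ne hij, ha]
    · simp [N, hcM]
  simp only [hdet, deriv_const_mul_field] at h0
  exact (mul_eq_zero.mp h0).resolve_left (mul_ne_zero hj hi)

variable {V : Type*} [AddCommGroup V] [Module ℂ V] [Module.Finite ℂ V]

/-- Take `v` outside the kernel of one eigenfunctional `η t` for each eigenvalue `t` of the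
transpose. If the `ℂ[P]`-span of `v` were proper, its annihilator, stable under the transpose, would
contain an eigenfunctional killing `v`; this is independent of the `η t` with the same eigenvalue.
-/
lemma exists_cyclic_of_dual_eigenspaces (P : Module.End ℂ V)
    (hP : ∀ (t : ℂ) (η θ : Module.Dual ℂ V), η ∘ₗ P = t • η → θ ∘ₗ P = t • θ →
      ¬ LinearIndependent ℂ ![η, θ]) :
    ∃ v, LinearIndependent ℂ (fun k : Fin (Module.finrank ℂ V) => (P ^ (k : ℕ)) v) := by
  let T : Module.End ℂ (Module.Dual ℂ V) := P.dualMap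
  have hT : ∀ t η, T.HasEigenvector t η ↔ η ∘ₗ P = t • η ∧ η ≠ 0 := fun t η => by
    rw [Module.End.hasEigenvector_iff, Module.End.mem_eigenspace_iff]; rfl
  choose η hη using fun t : T.Eigenvalues => Module.End.HasEigenvalue.exists_hasEigenvector t.2
  obtain ⟨v, hv⟩ := Module.Dual.exists_forall_ne_zero_of_forall_exists η fun t => by
    by_contra! h
    exact (hη t).2 (LinearMap.ext h)
  refine ⟨v, ?_⟩
  let S : Submodule ℂ V :=
    LinearMap.range ((LinearMap.applyₗ v) ∘ₗ (Polynomial.aeval P).toLinearMap)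
  have hmem : ∀ x, x ∈ S ↔ ∃ p : Polynomial ℂ, Polynomial.aeval P p v = x := fun x => by
    simp [S]
  have hS : S = ⊤ := by
    by_contra hS
    have hne : S.dualAnnihilator ≠ ⊥ := by
      rwa [Ne, Submodule.dualAnnihilator_eq_bot_iff]
    have hinv : ∀ θ ∈ S.dualAnnihilator, T θ ∈ S.dualAnnihilator := by
      intro θ hθ
      rw [Submodule.mem_dualAnnihilator] at hθ ⊢
      intro w hw
      obtain ⟨p, rfl⟩ := (hmem w).mp hw
      exact hθ _ ((hmem _).mpr ⟨Polynomial.X * p, by simp⟩)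
    have : Nontrivial S.dualAnnihilator := (Submodule.nontrivial_iff_ne_bot).mpr hne
    obtain ⟨t, ht⟩ := Module.End.exists_eigenvalue (T.restrict hinv)
    obtain ⟨θ, hθ⟩ := ht.exists_hasEigenvector
    have hθ0 : (θ : Module.Dual ℂ V) ≠ 0 := by simpa using hθ.2
    have hθT : T.HasEigenvector t θ := by
      rw [Module.End.hasEigenvector_iff, Module.End.mem_eigenspace_iff]
      refine ⟨?_, hθ0⟩
      simpa using congrArg Subtype.val (Module.End.mem_eigenspace_iff.mp hθ.1)
    let t' : T.Eigenvalues := ⟨t, Module.End.hasEigenvalue_of_hasEigenvector hθT⟩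
    have hθv : (θ : Module.Dual ℂ V) v = 0 :=
      (Submodule.mem_dualAnnihilator _).mp θ.2 v ((hmem v).mpr ⟨1, by simp⟩)
    refine hP t (η t') θ ((hT _ _).mp (hη t')).1 ((hT _ _).mp hθT).1 ?_
    rw [LinearIndependent.pair_iff]
    intro a b hab
    have h1 : a = 0 := by
      have := congrArg (fun φ : Module.Dual ℂ V => φ v) hab
      simpa [hθv, hv t'] using this
    refine ⟨h1, ?_⟩
    simpa [h1, hθ.2] using hab
  refine linearIndependent_of_top_le_span_of_card_eq_finrank ?_ (by simp)
  rintro x -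
  obtain ⟨p, rfl⟩ := (hmem x).mp (hS ▸ Submodule.mem_top)
  -- By Cayley–Hamilton, powers below the dimension suffice.
  have hp : Polynomial.aeval P p = Polynomial.aeval P (p %ₘ P.charpoly) := by
    conv_lhs => rw [← Polynomial.modByMonic_add_div p P.charpoly]
    simp [LinearMap.aeval_self_charpoly]
  -- In dimension zero the characteristic polynomial is `1` and the degree bound on the remainder
  -- fails.
  rcases Nat.eq_zero_or_pos (Module.finrank ℂ V) with h0 | h0
  · have := Module.finrank_zero_iff.mp h0
    rw [Subsingleton.elim (Polynomial.aeval P p v) 0]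
    exact Submodule.zero_mem _
  have hdeg : (p %ₘ P.charpoly).natDegree < Module.finrank ℂ V := by
    rw [← LinearMap.charpoly_natDegree P]
    refine Polynomial.natDegree_modByMonic_lt _ P.charpoly_monic fun h1 => ?_
    rw [← LinearMap.charpoly_natDegree P, h1] at h0
    simp at h0
  rw [hp, (p %ₘ P.charpoly).as_sum_range' _ hdeg]
  simp only [map_sum, LinearMap.sum_apply, Polynomial.aeval_monomial]
  refine Submodule.sum_mem _ fun k hk => ?_
  rw [← Algebra.smul_def]
  exact Submodule.smul_mem _ _ (Submodule.subset_span ⟨⟨k, Finset.mem_range.mp hk⟩, rfl⟩)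

-- An endomorphism commuting with `P` is determined by its value on a cyclic vector.
omit [Module.Finite ℂ V] in
lemma eq_sum_pow_of_commute {r : ℕ} {P f : Module.End ℂ V} (hf : ∀ x, f (P x) = P (f x)) {v : V}
    (hv : ⊤ ≤ Submodule.span ℂ (Set.range fun k : Fin r => (P ^ (k : ℕ)) v)) {g : Fin r → ℂ}
    (hg : f v = ∑ k, g k • (P ^ (k : ℕ)) v) : f = ∑ k, g k • P ^ (k : ℕ) := by
  have hc : Commute f P := LinearMap.ext hf
  refine LinearMap.ext_on_range (top_le_iff.mp hv) fun k => ?_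
  have h1 : f ((P ^ (k : ℕ)) v) = (P ^ (k : ℕ)) (f v) :=
    LinearMap.congr_fun (hc.pow_right k) v
  rw [h1, hg]
  simp only [map_sum, map_smul, LinearMap.sum_apply, LinearMap.smul_apply]
  refine Finset.sum_congr rfl fun l _ => ?_
  congr 1
  rw [← Module.End.mul_apply, ← Module.End.mul_apply, ← pow_add, ← pow_add, add_comm]

/-- The form conjugates `t - P` into the transpose of `t + P`, so in even dimension the
characteristic polynomial is an even function. -/
lemma charpoly_derivative_eval_zero {B : V →ₗ[ℂ] V →ₗ[ℂ] ℂ} (hB : ∀ v, (∀ w, B v w = 0) → v = 0)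
    {P : Module.End ℂ V} (hP : ∀ v w, B (P v) w + B v (P w) = 0)
    (heven : Even (Module.finrank ℂ V)) : P.charpoly.derivative.eval 0 = 0 := by
  let e : V ≃ₗ[ℂ] Module.Dual ℂ V := LinearEquiv.ofInjectiveOfFinrankEq B
    ((injective_iff_map_eq_zero B).mpr fun v hv => hB v fun w => by simp [hv])
    Subspace.dual_finrank_eq.symm
  have hev : ∀ t : ℂ, P.charpoly.eval (-t) = P.charpoly.eval t := by
    intro t
    rw [LinearMap.eval_charpoly, LinearMap.eval_charpoly]
    have h1 : algebraMap ℂ (Module.End ℂ V) (-t) - P = -(algebraMap ℂ (Module.End ℂ V) t + P) := by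
      rw [map_neg]; abel
    have h2 : (e : V →ₗ[ℂ] Module.Dual ℂ V) ∘ₗ (algebraMap ℂ (Module.End ℂ V) t - P) ∘ₗ
        (e.symm : Module.Dual ℂ V →ₗ[ℂ] V) = (algebraMap ℂ (Module.End ℂ V) t + P).dualMap := by
      refine LinearMap.ext fun η => LinearMap.ext fun w => ?_
      obtain ⟨v, rfl⟩ := e.surjective η
      have he : ∀ v, e v = B v := fun v => rfl
      have := hP v w
      simp only [LinearMap.comp_apply, LinearEquiv.coe_coe, LinearEquiv.symm_apply_apply]
      simp only [he, LinearMap.sub_apply, LinearMap.add_apply, Module.algebraMap_end_apply, map_sub, map_smul,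
        LinearMap.smul_apply, LinearMap.dualMap_apply, map_add]
      linear_combination -this
    rw [h1, ← neg_one_smul ℂ, LinearMap.det_smul, heven.neg_one_pow, one_mul,
      ← LinearMap.det_dualMap, ← h2, LinearMap.det_conj]
  have hcomp : P.charpoly.comp (-Polynomial.X) = P.charpoly :=
    Polynomial.funext fun t => by simp [hev]
  have := congrArg (fun p => p.derivative.eval 0) hcomp
  simp only [Polynomial.derivative_comp, Polynomial.derivative_neg, Polynomial.derivative_X,
    Polynomial.eval_mul, Polynomial.eval_neg, Polynomial.eval_one, Polynomial.eval_comp,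
    Polynomial.eval_X, neg_zero] at this
  linear_combination (-1/2) * this

end LinearAlgebra

/-! ### Twisted endomorphisms and negative powers of a line, read in a frame. -/

section Contract

variable {K M M' : Type*} [AddCommGroup K] [Module ℂ K] [AddCommGroup M] [Module ℂ M]
  [AddCommGroup M'] [Module ℂ M']

lemma contract_smul (Φ : M →ₗ[ℂ] K ⊗[ℂ] M) (a : ℂ) (ξ : Module.Dual ℂ K) :
    contract Φ (a • ξ) = a • contract Φ ξ := by
  ext v
  simp [contract, LinearMap.rTensor_smul]

lemma tmul_contract (hK : Module.finrank ℂ K = 1) {ℓ : K} {ξ : Module.Dual ℂ K} (h : ξ ℓ = 1)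
    (Φ : M →ₗ[ℂ] K ⊗[ℂ] M) (v : M) : Φ v = ℓ ⊗ₜ[ℂ] contract Φ ξ v := by
  simp only [contract, LinearMap.comp_apply, LinearEquiv.coe_coe]
  induction Φ v using TensorProduct.induction_on with
  | zero => simp
  | tmul k m =>
    conv_lhs => rw [eq_smul_of_dual_eq_one hK h k]
    simp [TensorProduct.smul_tmul]
  | add x y hx hy =>
    conv_lhs => rw [hx, hy]
    rw [map_add, map_add, TensorProduct.tmul_add]

lemma lid_rTensor_lTensor (ξ : Module.Dual ℂ K) (ψ : M →ₗ[ℂ] M') (x : K ⊗[ℂ] M) :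
    TensorProduct.lid ℂ M' (LinearMap.rTensor M' ξ (ψ.lTensor K x)) =
      ψ (TensorProduct.lid ℂ M (LinearMap.rTensor M ξ x)) := by
  induction x using TensorProduct.induction_on with
  | zero => simp
  | tmul k m => simp
  | add x y hx hy => simp only [map_add, hx, hy]

lemma contract_comm {Φ : M →ₗ[ℂ] K ⊗[ℂ] M} {Φ' : M' →ₗ[ℂ] K ⊗[ℂ] M'} {ψ : M →ₗ[ℂ] M'} {v : M}
    (h : ψ.lTensor K (Φ v) = Φ' (ψ v)) (ξ : Module.Dual ℂ K) :
    contract Φ' ξ (ψ v) = ψ (contract Φ ξ v) := by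
  simp only [contract, LinearMap.comp_apply, LinearEquiv.coe_coe, ← h, lid_rTensor_lTensor]

lemma lTensor_of_contract_comm (hK : Module.finrank ℂ K = 1) {ℓ : K} {ξ : Module.Dual ℂ K}
    (hξ : ξ ℓ = 1) {Φ : M →ₗ[ℂ] K ⊗[ℂ] M} {Φ' : M' →ₗ[ℂ] K ⊗[ℂ] M'} {ψ : M →ₗ[ℂ] M'} {v : M}
    (h : contract Φ' ξ (ψ v) = ψ (contract Φ ξ v)) : ψ.lTensor K (Φ v) = Φ' (ψ v) := by
  rw [tmul_contract hK hξ Φ' (ψ v), h, tmul_contract hK hξ Φ v, LinearMap.lTensor_tmul]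

/-- The power `ξ ^ n` of a functional, as an `n`-linear form. -/
noncomputable def dualPow (n : ℕ) (ξ : Module.Dual ℂ K) : MultilinearMap ℂ (fun _ : Fin n => K) ℂ :=
  (MultilinearMap.mkPiAlgebra ℂ (Fin n) ℂ).compLinearMap fun _ => ξ

@[simp] lemma dualPow_apply (n : ℕ) (ξ : Module.Dual ℂ K) (m : Fin n → K) :
    dualPow n ξ m = ∏ k, ξ (m k) := rfl

lemma multilinear_eq_smul_dualPow (hK : Module.finrank ℂ K = 1) {n : ℕ} {ℓ : K}
    {ξ : Module.Dual ℂ K} (h : ξ ℓ = 1) (w : MultilinearMap ℂ (fun _ : Fin n => K) ℂ) :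
    w = (w fun _ => ℓ) • dualPow n ξ := by
  ext m
  have : m = fun k => ξ (m k) • ℓ := funext fun k => eq_smul_of_dual_eq_one hK h (m k)
  conv_lhs => rw [this, MultilinearMap.map_smul_univ]
  simp [mul_comm]

lemma multilinear_ext_of_line (hK : Module.finrank ℂ K = 1) {n : ℕ} {ℓ : K}
    {ξ : Module.Dual ℂ K} (h : ξ ℓ = 1) {w w' : MultilinearMap ℂ (fun _ : Fin n => K) ℂ}
    (hw : (w fun _ => ℓ) = w' fun _ => ℓ) : w = w' := by
  rw [multilinear_eq_smul_dualPow hK h w, multilinear_eq_smul_dualPow hK h w', hw]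

end Contract

/-! ### Division by a coordinate, density arguments and constancy on compact curves. -/

section LocalAnalysis

open Filter Topology

variable {X : Type u} [TopologicalSpace X] [ChartedSpace ℂ X] {U W : Set X} {f g : X → ℂ} {x : X}

lemma compl_singleton_nhdsWithin_neBot (x : X) : (𝓝[≠] x).NeBot := by
  rw [neBot_iff, Ne, ← isOpen_singleton_iff_punctured_nhds]
  intro h
  have := (chartAt ℂ x).isOpen_image_of_subset_source h (by simp)
  rw [Set.image_singleton, isOpen_singleton_iff_punctured_nhds] at this
  exact NeBot.ne inferInstance this

lemma HolFun.analyticAt [IsManifold 𝓘(ℂ) ω X] (hf : HolFun U f) (hU : IsOpen U) (hx : x ∈ U) :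
    AnalyticAt ℂ (fun z => f ((chartAt ℂ x).symm z)) (chartAt ℂ x x) := by
  have h1 : ContMDiffAt 𝓘(ℂ) 𝓘(ℂ) ω (chartAt ℂ x).symm (chartAt ℂ x x) :=
    (contMDiffOn_chart_symm (I := 𝓘(ℂ)) (n := ω) (x := x)).contMDiffAt
      ((chartAt ℂ x).open_target.mem_nhds (mem_chart_target ℂ x))
  have h2 : ContMDiffAt 𝓘(ℂ) 𝓘(ℂ) ω f ((chartAt ℂ x).symm (chartAt ℂ x x)) := by
    rw [(chartAt ℂ x).left_inv (mem_chart_source ℂ x)]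
    exact ContMDiffOn.contMDiffAt hf (hU.mem_nhds hx)
  exact (contMDiffAt_iff_contDiffAt.mp (h2.comp _ h1)).analyticAt

lemma holFun_chartAt [IsManifold 𝓘(ℂ) ω X] (x : X) :
    HolFun (chartAt ℂ x).source (chartAt ℂ x) :=
  contMDiffOn_chart (I := 𝓘(ℂ)) (n := ω) (x := x)

lemma holFun_chartAt_sub [IsManifold 𝓘(ℂ) ω X] (x : X) :
    HolFun (chartAt ℂ x).source (fun y => chartAt ℂ x y - chartAt ℂ x x) :=
  ((holFun_chartAt x).add (HolFun.const (-(chartAt ℂ x x)))).congr fun _ _ => sub_eq_add_neg _ _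

lemma chartAt_sub_ne_zero {y : X} (hy : y ∈ (chartAt ℂ x).source) (hyx : y ≠ x) :
    chartAt ℂ x y - chartAt ℂ x x ≠ 0 := fun h =>
  hyx ((chartAt ℂ x).injOn hy (mem_chart_source ℂ x) (sub_eq_zero.mp h))

lemma HolFun.exists_eq_mul [IsManifold 𝓘(ℂ) ω X] (hf : HolFun U f) (hU : IsOpen U) (hx : x ∈ U)
    (h0 : f x = 0) : ∃ W ⊆ U, IsOpen W ∧ x ∈ W ∧ W ⊆ (chartAt ℂ x).source ∧ ∃ g, HolFun W g ∧
      ∀ y ∈ W, f y = (chartAt ℂ x y - chartAt ℂ x x) * g y := by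
  let φ := chartAt ℂ x
  let F : ℂ → ℂ := fun z => f (φ.symm z)
  have hF : AnalyticAt ℂ F (φ x) := hf.analyticAt hU hx
  -- The quotient by the centred coordinate is the divided slope, which stays analytic at the
  -- centre.
  have hG : AnalyticAt ℂ (dslope F (φ x)) (φ x) := by
    obtain ⟨p, hp⟩ := hF
    exact ⟨_, hp.has_fpower_series_dslope_fslope⟩
  let S := {z | AnalyticAt ℂ (dslope F (φ x)) z}
  have hS : IsOpen S := isOpen_analyticAt ℂ _
  let W := (φ.source ∩ φ ⁻¹' S) ∩ U
  refine ⟨W, Set.inter_subset_right, (φ.isOpen_inter_preimage hS).inter hU,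
    ⟨⟨mem_chart_source ℂ x, hG⟩, hx⟩, fun y hy => hy.1.1, fun y => dslope F (φ x) (φ y), ?_, ?_⟩
  · intro y hy
    have h1 : ContDiffAt ℂ ω (dslope F (φ x)) (φ y) := AnalyticAt.contDiffAt hy.1.2
    exact h1.contMDiffAt.comp_contMDiffWithinAt y
      ((holFun_chartAt x).mono (fun y hy => hy.1.1) y hy)
  · intro y hy
    have := sub_smul_dslope F (φ x) (φ y)
    rw [smul_eq_mul] at this
    simp only [F, φ.left_inv hy.1.1, φ.left_inv (mem_chart_source ℂ x), h0, sub_zero] at this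
    exact this.symm

lemma HolFun.exists_forall_ne_zero [IsManifold 𝓘(ℂ) ω X] (hf : HolFun U f) (hU : IsOpen U)
    (hx : x ∈ U) (hd : deriv (fun z => f ((chartAt ℂ x).symm z)) (chartAt ℂ x x) ≠ 0) :
    ∃ W ⊆ U, IsOpen W ∧ x ∈ W ∧ ∀ y ∈ W, y ≠ x → f y ≠ 0 := by
  let φ := chartAt ℂ x
  have h1 := (hf.analyticAt hU hx).differentiableAt.hasDerivAt.eventually_ne hd (c := 0)
  rw [eventually_nhdsWithin_iff] at h1
  obtain ⟨S, hSs, hS, hxS⟩ := mem_nhds_iff.mp h1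
  refine ⟨(φ.source ∩ φ ⁻¹' S) ∩ U, Set.inter_subset_right,
    (φ.isOpen_inter_preimage hS).inter hU, ⟨⟨mem_chart_source ℂ x, hxS⟩, hx⟩, fun y hy hyx => ?_⟩
  have := hSs hy.1.2 fun h => hyx (φ.injOn hy.1.1 (mem_chart_source ℂ x) h)
  simpa [φ.left_inv hy.1.1, φ] using this

lemma HolFun.const_of_compact [IsManifold 𝓘(ℂ) ω X] [CompactSpace X] [ConnectedSpace X]
    (hf : HolFun Set.univ f) (a b : X) : f a = f b := by
  have h : ContMDiff 𝓘(ℂ) 𝓘(ℂ) ω f := contMDiffOn_univ.mp hf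
  exact MDifferentiable.apply_eq_of_compactSpace (I := 𝓘(ℂ)) (h.mdifferentiable (by simp)) a b

variable {D : Set X}

omit [ChartedSpace ℂ X] in
lemma eq_of_eqOn_diff {α : Type*} [TopologicalSpace α] [T2Space α] {f g : X → α}
    (hD : Dense Dᶜ) (hU : IsOpen U) (hf : ContinuousOn f U) (hg : ContinuousOn g U)
    (h : ∀ y ∈ U \ D, f y = g y) : ∀ y ∈ U, f y = g y := by
  have h1 : U ⊆ closure (U \ D) := hD.open_subset_closure_inter hU
  exact Set.EqOn.of_subset_closure (s := U \ D) h hf hg Set.sdiff_subset h1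

lemma HolBundle.HolSection.eq_of_eqOn_diff {r : ℕ} {E : HolBundle.{u, v} X r}
    {s t : ∀ x, E.Fiber x} (hD : Dense Dᶜ) (hU : IsOpen U) (hs : E.HolSection U s)
    (ht : E.HolSection U t) (h : ∀ y ∈ U \ D, s y = t y) : ∀ y ∈ U, s y = t y := by
  intro y hy
  obtain ⟨V, hV, hyV, e, κ, hf⟩ := E.exists_isFrame y
  have hUV := hU.inter hV
  have key : ∀ j, κ j y (s y) = κ j y (t y) := fun j =>
    _root_.eq_of_eqOn_diff hD hUV
      (hf.coord_hol _ Set.inter_subset_right hUV s (hs.mono Set.inter_subset_left) j).continuousOn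
      (hf.coord_hol _ Set.inter_subset_right hUV t (ht.mono Set.inter_subset_left) j).continuousOn
      (fun z hz => by rw [h z ⟨hz.1.1, hz.2⟩]) y ⟨hy, hyV⟩
  rw [← hf.sum_eq y hyV (s y), ← hf.sum_eq y hyV (t y)]
  simp only [key]

lemma HolBundle.HolSection.exists_eq_smul [IsManifold 𝓘(ℂ) ω X] {r : ℕ} {E : HolBundle.{u, v} X r}
    {s : ∀ x, E.Fiber x} (hs : E.HolSection U s) (hU : IsOpen U) (hx : x ∈ U) (h0 : s x = 0) :
    ∃ W ⊆ U, IsOpen W ∧ x ∈ W ∧ W ⊆ (chartAt ℂ x).source ∧ ∃ t, E.HolSection W t ∧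
      ∀ y ∈ W, s y = (chartAt ℂ x y - chartAt ℂ x x) • t y := by
  obtain ⟨V, hV, hxV, e, κ, hf⟩ := E.exists_isFrame x
  have hUV := hU.inter hV
  have hcoord := fun j => (hf.coord_hol _ Set.inter_subset_right hUV s
    (hs.mono Set.inter_subset_left) j).exists_eq_mul hUV ⟨hx, hxV⟩ (by simp [h0])
  choose W hWU hW hxW hWs g hg hgW using hcoord
  let W' := (U ∩ V ∩ (chartAt ℂ x).source) ∩ ⋂ j, W j
  have hW'V : W' ⊆ V := fun y hy => hy.1.1.2
  have hW'W : ∀ j, W' ⊆ W j := fun j y hy => Set.mem_iInter.mp hy.2 j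
  refine ⟨W', fun y hy => hy.1.1.1, (hUV.inter (chartAt ℂ x).open_source).inter
    (isOpen_iInter_of_finite hW), ⟨⟨⟨hx, hxV⟩, mem_chart_source ℂ x⟩, Set.mem_iInter.mpr hxW⟩,
    fun y hy => hy.1.2, fun y => ∑ j, g j y • e j y, ?_, ?_⟩
  · exact HolSection.sum fun j _ => HolSection.smul ((hg j).mono (hW'W j)) ((hf.hol j).mono hW'V)
  · intro y hy
    rw [← hf.sum_eq y (hW'V hy) (s y), Finset.smul_sum]
    exact Finset.sum_congr rfl fun j _ => by rw [hgW j y (hW'W j hy), mul_smul]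

/-- A family of values that is determined off a set with dense complement, and is given near each
point by a holomorphic function, is constant on a compact connected curve. -/
lemma exists_const_of_locally_holFun [IsManifold 𝓘(ℂ) ω X] [CompactSpace X] [ConnectedSpace X]
    (hD : Dense Dᶜ) {R : X → ℂ → Prop} (hfun : ∀ y ∉ D, ∀ a b, R y a → R y b → a = b)
    (hloc : ∀ x, ∃ W, IsOpen W ∧ x ∈ W ∧ ∃ h, HolFun W h ∧ ∀ y ∈ W \ D, R y (h y)) :
    ∃ C, ∀ W, IsOpen W → ∀ h, HolFun W h → (∀ y ∈ W \ D, R y (h y)) → ∀ x ∈ W, h x = C := by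
  choose V hV hxV H hH hR using hloc
  have hagree : ∀ W, IsOpen W → ∀ h, HolFun W h → (∀ y ∈ W \ D, R y (h y)) →
      ∀ x ∈ W, H x x = h x := by
    intro W hW h hh hhR x hx
    exact eq_of_eqOn_diff hD ((hV x).inter hW) ((hH x).mono Set.inter_subset_left).continuousOn
      (hh.mono Set.inter_subset_right).continuousOn
      (fun y hy => hfun y hy.2 _ _ (hR x y ⟨hy.1.1, hy.2⟩) (hhR y ⟨hy.1.2, hy.2⟩)) x ⟨hxV x, hx⟩
  -- The local functions agree on overlaps, so the diagonal `x ↦ H x x` coincides near each point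
  -- with one of them.
  have hglob : HolFun Set.univ (fun x => H x x) := HolFun.of_locally fun x _ =>
    ⟨V x, hV x, hxV x, ((hH x).mono Set.inter_subset_right).congr fun y hy =>
      hagree _ (hV x) _ (hH x) (hR x) y hy.2⟩
  obtain ⟨x₀⟩ : Nonempty X := inferInstance
  exact ⟨H x₀ x₀, fun W hW h hh hhR x hx => by
    rw [← hagree W hW h hh hhR x hx]
    exact hglob.const_of_compact x x₀⟩

end LocalAnalysis

/-! ### Consequences of smoothness of the spectral curve. -/

section Spectral

variable {X : Type u} [TopologicalSpace X] [ChartedSpace ℂ X]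

namespace SpHiggsBundle

variable {L : HolBundle.{u, v} X 1} {n : ℕ} (H : SpHiggsBundle.{u, v, v₁} L n)
  {U W : Set X} {ℓ : ∀ x, L.Fiber x} {ξ : ∀ x, Module.Dual ℂ (L.Fiber x)}

lemma charPoly_eval {e : Fin (2 * n) → ∀ x, H.E.Fiber x}
    {κ : Fin (2 * n) → ∀ x, Module.Dual ℂ (H.E.Fiber x)} (he : H.E.IsFrame U e κ) {y : X}
    (hy : y ∈ U) (η : Module.Dual ℂ (L.Fiber y)) (t : ℂ) :
    (H.charPoly y η).eval t = (Matrix.scalar (Fin (2 * n)) t -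
      Matrix.of fun i j => κ i y (contract (H.Φ y) η (e j y))).det := by
  rw [charPoly, ← LinearMap.charpoly_toMatrix _ (he.basis hy), Matrix.eval_charpoly]
  congr 2
  ext i j
  rw [LinearMap.toMatrix_apply, he.basis_repr, he.basis_apply]
  rfl

lemma holFun_coord_contract (hℓ : IsLineFrame L U ℓ ξ) (hU : IsOpen U)
    {e : Fin (2 * n) → ∀ x, H.E.Fiber x} {κ : Fin (2 * n) → ∀ x, Module.Dual ℂ (H.E.Fiber x)}
    (he : H.E.IsFrame U e κ) (i j : Fin (2 * n)) :
    HolFun U (fun y => κ i y (contract (H.Φ y) (ξ y) (e j y))) :=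
  he.coord_hol U subset_rfl hU _ (H.Φ_hol U hU ℓ ξ hℓ _ (he.hol j)) i

lemma holFun_charPoly_eval (hℓ : IsLineFrame L U ℓ ξ) (hU : IsOpen U) (t : ℂ) :
    HolFun U (fun y => (H.charPoly y (ξ y)).eval t) := by
  refine HolFun.of_locally fun x hx => ?_
  obtain ⟨V, hV, hxV, e, κ, he⟩ := H.E.exists_isFrame x
  refine ⟨V, hV, hxV, ?_⟩
  have he' := he.mono (W := U ∩ V) Set.inter_subset_right
  refine HolFun.congr (HolFun.det (M := fun y => Matrix.scalar (Fin (2 * n)) t -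
      Matrix.of fun i j => κ i y (contract (H.Φ y) (ξ y) (e j y))) fun i j => ?_)
    fun y hy => H.charPoly_eval he' hy (ξ y) t
  simp only [Matrix.sub_apply, Matrix.of_apply]
  refine ((HolFun.const (Matrix.scalar (Fin (2 * n)) t i j)).add ((HolFun.const (-1)).mul
    (H.holFun_coord_contract (hℓ.mono Set.inter_subset_left) (hU.inter hV) he' i j))).congr
    fun y _ => by ring

lemma a_top (x : X) (η : Module.Dual ℂ (L.Fiber x)) :
    H.a (2 * n) x η = (H.charPoly x η).eval 0 := by
  simp [a, Polynomial.coeff_zero_eq_eval_zero]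

lemma a_top_eq_det (x : X) (η : Module.Dual ℂ (L.Fiber x)) :
    H.a (2 * n) x η = LinearMap.det (contract (H.Φ x) η) := by
  rw [LinearMap.det_eq_sign_charpoly_coeff, H.E.finrank_fiber, Even.neg_one_pow ⟨n, two_mul n⟩]
  simp [a, charPoly]

lemma mem_D_iff {x : X} {ℓ : L.Fiber x} {η : Module.Dual ℂ (L.Fiber x)} (h : η ℓ = 1) :
    x ∈ H.D ↔ LinearMap.det (contract (H.Φ x) η) = 0 := by
  refine ⟨fun hx => ?_, fun h0 θ _ => ?_⟩
  · rw [← a_top_eq_det]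
    exact hx η (by rintro rfl; simp at h)
  · have : θ = θ ℓ • η := LinearMap.ext fun v => by
      conv_lhs => rw [eq_smul_of_dual_eq_one (L.finrank_fiber x) h v]
      simp [mul_comm]
    rw [a_top_eq_det, this, contract_smul, LinearMap.det_smul, h0, mul_zero]

lemma derivative_charPoly_eval_zero {x : X} {ℓ : L.Fiber x} {η : Module.Dual ℂ (L.Fiber x)}
    (h : η ℓ = 1) : (H.charPoly x η).derivative.eval 0 = 0 := by
  refine charpoly_derivative_eval_zero (B := (H.form x).compr₂ η) (fun v hv => ?_)
    (fun v w => ?_) (by rw [H.E.finrank_fiber]; exact even_two_mul n)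
  · refine H.form_nondeg x v fun w => ?_
    rw [eq_smul_of_dual_eq_one (L.finrank_fiber x) h (H.form x v w)]
    have := hv w
    simp only [LinearMap.compr₂_apply] at this
    rw [this, zero_smul]
  · simp only [LinearMap.compr₂_apply, ← map_add, H.form_compat, map_zero]

variable {H}

/-- Over `D` the point `λ = 0` lies on the spectral curve, and the `λ`-derivative vanishes there
because the characteristic polynomial is even. Smoothness leaves only the base derivative, that of
`a_{2n}`: its zeros are simple, hence isolated. -/
lemma deriv_a_ne_zero (hH : H.SmoothSpectralCurve) (hU : IsOpen U) (hℓ : IsLineFrame L U ℓ ξ)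
    {x : X} (hx : x ∈ U) (hxD : x ∈ H.D) :
    deriv (fun z : ℂ => H.a (2 * n) ((chartAt ℂ x).symm z) (ξ ((chartAt ℂ x).symm z)))
      (chartAt ℂ x x) ≠ 0 := by
  have h0 : (H.charPoly x (ξ x)).eval 0 = 0 := by
    rw [← a_top]; exact hxD _ (hℓ.dual_ne_zero hx)
  have := (hH U hU ℓ ξ hℓ x hx 0 h0).resolve_left
    (not_not.mpr (H.derivative_charPoly_eval_zero (hℓ.2 x hx)))
  simpa only [a_top] using this

lemma mem_D_iff_a (hℓ : IsLineFrame L U ℓ ξ) {x : X} (hx : x ∈ U) :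
    x ∈ H.D ↔ H.a (2 * n) x (ξ x) = 0 := by
  rw [a_top_eq_det, H.mem_D_iff (hℓ.2 x hx)]

variable [IsManifold 𝓘(ℂ) ω X]

lemma exists_nhds_inter_D_subset (hH : H.SmoothSpectralCurve) (x : X) :
    ∃ W, IsOpen W ∧ x ∈ W ∧ ∀ y ∈ W, y ∈ H.D → y = x := by
  obtain ⟨U, hU, hxU, ℓ, ξ, hℓ⟩ := exists_isLineFrame L x
  have ha : HolFun U (fun y => H.a (2 * n) y (ξ y)) := by
    simpa only [a_top] using H.holFun_charPoly_eval hℓ hU 0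
  by_cases hxD : x ∈ H.D
  · obtain ⟨W, hWU, hW, hxW, h⟩ := ha.exists_forall_ne_zero hU hxU
      (deriv_a_ne_zero hH hU hℓ hxU hxD)
    refine ⟨W, hW, hxW, fun y hy hyD => ?_⟩
    by_contra hyx
    exact h y hy hyx ((mem_D_iff_a hℓ (hWU hy)).mp hyD)
  · refine ⟨U ∩ (fun y => H.a (2 * n) y (ξ y)) ⁻¹' {0}ᶜ,
      ha.continuousOn.isOpen_inter_preimage hU isOpen_compl_singleton,
      ⟨hxU, fun h => hxD ((mem_D_iff_a hℓ hxU).mpr h)⟩, fun y hy hyD => ?_⟩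
    exact absurd ((mem_D_iff_a hℓ hy.1).mp hyD) hy.2

lemma dense_compl_D (hH : H.SmoothSpectralCurve) : Dense H.Dᶜ := by
  intro x
  obtain ⟨W, hW, hxW, h⟩ := exists_nhds_inter_D_subset hH x
  have := compl_singleton_nhdsWithin_neBot x
  refine mem_closure_iff_frequently.mpr ?_
  have h1 : ∀ᶠ y in nhdsWithin x {x}ᶜ, y ∈ H.Dᶜ := by
    filter_upwards [nhdsWithin_le_nhds (hW.mem_nhds hxW), self_mem_nhdsWithin] with y hy hyx hyD
    exact hyx (h y hy hyD)
  exact h1.frequently.filter_mono nhdsWithin_le_nhds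

/-- If some eigenvalue `t` had two independent left eigenvectors, `t - Φ_x` would have corank at
least two and the spectral curve would be singular at `(x, t)`. So `Φ_x` is regular, even where it
is not invertible. -/
lemma exists_cyclic (hH : H.SmoothSpectralCurve) (hU : IsOpen U) (hℓ : IsLineFrame L U ℓ ξ)
    {x : X} (hx : x ∈ U) :
    ∃ v, LinearIndependent ℂ
      (fun k : Fin (2 * n) => (contract (H.Φ x) (ξ x) ^ (k : ℕ)) v) := by
  suffices h : ∃ v, LinearIndependent ℂ (fun k : Fin (Module.finrank ℂ (H.E.Fiber x)) =>
      (contract (H.Φ x) (ξ x) ^ (k : ℕ)) v) by rwa [H.E.finrank_fiber] at h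
  refine exists_cyclic_of_dual_eigenspaces _ fun t η θ hη hθ hli => ?_
  obtain ⟨V, hV, hxV, e, κ, he⟩ := H.E.exists_isFrame x
  have hUV := hU.inter hV
  have he' := he.mono (W := U ∩ V) Set.inter_subset_right
  have hℓ' := hℓ.mono (W := U ∩ V) Set.inter_subset_left
  have hx' : x ∈ U ∩ V := ⟨hx, hxV⟩
  let M : X → Matrix (Fin (2 * n)) (Fin (2 * n)) ℂ := fun y =>
    Matrix.of fun i j => κ i y (contract (H.Φ y) (ξ y) (e j y))
  let a : Fin (2 * n) → ℂ := fun j => η (e j x)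
  let b : Fin (2 * n) → ℂ := fun j => θ (e j x)
  have hvec : ∀ ζ : Module.Dual ℂ (H.E.Fiber x), ζ ∘ₗ contract (H.Φ x) (ξ x) = t • ζ →
      Matrix.vecMul (fun j => ζ (e j x)) (Matrix.scalar (Fin (2 * n)) t - M x) = 0 := by
    intro ζ hζ
    ext j
    have h1 := LinearMap.congr_fun hζ (e j x)
    simp only [LinearMap.comp_apply] at h1
    rw [← he.sum_eq x hxV (contract (H.Φ x) (ξ x) (e j x)), map_sum] at h1
    simp only [map_smul, smul_eq_mul, LinearMap.smul_apply] at h1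
    simp only [Matrix.vecMul_sub, Pi.sub_apply, Pi.zero_apply, Matrix.scalar_apply,
      Matrix.vecMul_diagonal]
    simp only [Matrix.vecMul, dotProduct, M, Matrix.of_apply]
    simp only [mul_comm] at h1 ⊢
    rw [h1, sub_self]
  have ha := hvec η hη
  have hb := hvec θ hθ
  have hab : LinearIndependent ℂ ![a, b] := by
    rw [LinearIndependent.pair_iff] at hli ⊢
    intro p q hpq
    refine hli p q (LinearMap.ext fun v => ?_)
    have h1 : ∀ j, p * η (e j x) + q * θ (e j x) = 0 := fun j => congrFun hpq j
    rw [← he.sum_eq x hxV v]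
    simp only [map_sum, map_smul, LinearMap.add_apply, LinearMap.smul_apply, smul_eq_mul, h1,
      mul_zero, Finset.sum_const_zero, LinearMap.zero_apply]
  have hsx := (chartAt ℂ x).left_inv (mem_chart_source ℂ x)
  have heval : (H.charPoly x (ξ x)).eval t = 0 := by
    rw [H.charPoly_eval he hxV]
    refine Matrix.exists_vecMul_eq_zero_iff.mp ⟨a, hab.ne_zero 0, ha⟩
  -- Corank two kills both partial derivatives: in `λ`, and along the base in the chart.
  rcases hH U hU ℓ ξ hℓ x hx t heval with h | h
  · refine h ?_
    have : ∀ s, (H.charPoly x (ξ x)).eval s = (Matrix.scalar (Fin (2 * n)) s - M x).det :=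
      fun s => H.charPoly_eval he hxV _ s
    rw [← Polynomial.deriv, funext this]
    refine deriv_det_eq_zero (fun k l => ?_) hab ha hb
    simp only [Matrix.sub_apply, Matrix.scalar_apply, Matrix.diagonal_apply]
    split_ifs <;> fun_prop
  · refine h ?_
    have hopen : (chartAt ℂ x).target ∩ (chartAt ℂ x).symm ⁻¹' (U ∩ V) ∈
        nhds (chartAt ℂ x x) :=
      ((chartAt ℂ x).isOpen_inter_preimage_symm hUV).mem_nhds
        ⟨mem_chart_target ℂ x, by simpa [hsx] using hx'⟩
    have hev : (fun z : ℂ => (H.charPoly ((chartAt ℂ x).symm z)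
        (ξ ((chartAt ℂ x).symm z))).eval t) =ᶠ[nhds (chartAt ℂ x x)]
        fun z => (Matrix.scalar (Fin (2 * n)) t - M ((chartAt ℂ x).symm z)).det := by
      filter_upwards [hopen] with z hz
      exact H.charPoly_eval he hz.2.2 _ t
    rw [hev.deriv_eq]
    refine deriv_det_eq_zero (fun k l => ?_) hab (by rwa [hsx]) (by rwa [hsx])
    simp only [Matrix.sub_apply]
    exact (differentiableAt_const _).sub
      ((H.holFun_coord_contract hℓ' hUV he' k l).analyticAt hUV hx').differentiableAt

end SpHiggsBundle

end Spectral

/-! ### Block form off `D` and test sections of a Hecke modification. -/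

section HeckeModifications

variable {X : Type u} [TopologicalSpace X] [ChartedSpace ℂ X]

namespace SpHiggsBundle

variable {L : HolBundle.{u, v} X 1} {n : ℕ} {H : SpHiggsBundle.{u, v, v₁} L n}

/-- The two summands are the image and the kernel of `(Φ, 0)`, as `Φ` is invertible off `D`; a map
commuting with `(Φ, 0)` preserves both. -/
lemma exists_blocks_of_bijective {x : X} (hx : x ∉ H.D)
    (F : H.ModelFiber x →ₗ[ℂ] H.ModelFiber x) (hF : Function.Injective F)
    (hcomm : ∀ (ξ : Module.Dual ℂ (L.Fiber x)) (t : H.ModelFiber x),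
      F (contract (H.Φ x) ξ ∘ₗ t.1, 0) = (contract (H.Φ x) ξ ∘ₗ (F t).1, 0)) :
    ∃ (f : Module.End ℂ (H.E.Fiber x)) (c : ℂ), c ≠ 0 ∧
      (∀ ξ v, f (contract (H.Φ x) ξ v) = contract (H.Φ x) ξ (f v)) ∧
      ∀ t, F t = (f ∘ₗ t.1, c • t.2) := by
  obtain ⟨U, hU, hxU, ℓ, ξ, hℓ⟩ := exists_isLineFrame L x
  have h1 := hℓ.2 x hxU
  have hL := L.finrank_fiber x
  have hdet : LinearMap.det (contract (H.Φ x) (ξ x)) ≠ 0 := fun h => hx ((H.mem_D_iff h1).mpr h)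
  let P : H.E.Fiber x ≃ₗ[ℂ] H.E.Fiber x := LinearMap.equivOfDetNeZero _ hdet
  have hP : (P : H.E.Fiber x →ₗ[ℂ] H.E.Fiber x) = contract (H.Φ x) (ξ x) := rfl
  have hext : ∀ α β : H.TwistFiber x, α (ℓ x) = β (ℓ x) → α = β := fun α β h =>
    LinearMap.ext fun v => by
      rw [eq_smul_of_dual_eq_one hL h1 v, map_smul, map_smul, h]
  have hF1 : ∀ α : H.TwistFiber x, (F (α, 0)).2 = 0 := by
    intro α
    have h2 := hcomm (ξ x) (P.symm.toLinearMap ∘ₗ α, 0)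
    have h3 : contract (H.Φ x) (ξ x) ∘ₗ P.symm.toLinearMap ∘ₗ α = α := by
      rw [← hP]; ext v; simp
    simp only [h3] at h2
    rw [h2]
  have hF2 : ∀ w : H.NegPowFiber x, (F (0, w)).1 = 0 := by
    intro w
    have h2 := hcomm (ξ x) (0, w)
    simp only [LinearMap.comp_zero, Prod.mk_zero_zero, map_zero] at h2
    have h3 := (Prod.mk.inj h2).1
    rw [← hP] at h3
    exact LinearMap.ext fun v => by
      have := LinearMap.congr_fun h3 v
      simpa using this.symm
  -- In the frame `ℓ` a vector `v` of `E` corresponds to `ξ ⊗ v` in `L⁻¹E`; evaluating at `ℓ`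
  -- inverts this.
  let f : Module.End ℂ (H.E.Fiber x) :=
    { toFun := fun v => (F ((ξ x).smulRight v, 0)).1 (ℓ x)
      map_add' := fun v w => by
        have : (((ξ x).smulRight (v + w), 0) : H.ModelFiber x) =
            ((ξ x).smulRight v, 0) + ((ξ x).smulRight w, 0) := by
          ext <;> simp
        rw [this, map_add]; rfl
      map_smul' := fun c v => by
        have : (((ξ x).smulRight (c • v), 0) : H.ModelFiber x) =
            c • ((ξ x).smulRight v, 0) := by
          exact Prod.ext (LinearMap.ext fun z => smul_comm _ _ _) (smul_zero c).symm
        rw [this, map_smul]; rfl }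
  let c : ℂ := (F (0, dualPow n (ξ x))).2 fun _ => ℓ x
  have hf : ∀ α : H.TwistFiber x, (F (α, 0)).1 = f ∘ₗ α := fun α => by
    refine hext _ _ ?_
    have : (ξ x).smulRight (α (ℓ x)) = α := hext _ _ (by simp [h1])
    change _ = (F ((ξ x).smulRight (α (ℓ x)), 0)).1 (ℓ x)
    rw [this]
  have hc : ∀ w : H.NegPowFiber x, (F (0, w)).2 = c • w := fun w => by
    refine multilinear_ext_of_line hL h1 ?_
    have h2 : ((0, w) : H.ModelFiber x) = (w fun _ => ℓ x) • (0, dualPow n (ξ x)) := by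
      rw [Prod.smul_mk, smul_zero, ← multilinear_eq_smul_dualPow hL h1 w]
    conv_lhs => rw [h2, map_smul]
    simp [c, mul_comm]
  refine ⟨f, c, fun hc0 => ?_, fun η v => ?_, fun t => ?_⟩
  · have h2 : F (0, dualPow n (ξ x)) = 0 :=
      Prod.ext (hF2 _) (by rw [hc, hc0, zero_smul]; rfl)
    have h3 := (Prod.mk.inj (hF (h2.trans (map_zero F).symm))).2
    have h4 := congrArg (fun w : H.NegPowFiber x => w fun _ => ℓ x) h3
    simp [h1] at h4
  · have h2 := congrArg Prod.fst (hcomm η ((ξ x).smulRight v, 0))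
    simp only [hf] at h2
    have := LinearMap.congr_fun h2 (ℓ x)
    simpa [h1] using this
  · have : t = (t.1, 0) + (0, t.2) := by simp
    conv_lhs => rw [this, map_add]
    exact Prod.ext (by simp [hf, hF2]) (by simp [hF1, hc])

variable {i i' : H.HeckeFamily} {U : Set X} {ℓ : ∀ x, L.Fiber x}
  {ξ : ∀ x, Module.Dual ℂ (L.Fiber x)} {e : ∀ x, H.E.Fiber x} {b : X → ℂ}

lemma isHeckeSection_of_disjoint (hU : ∀ y ∈ U, y ∉ H.D) (hℓ : IsLineFrame L U ℓ ξ)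
    (he : H.E.HolSection U e) (hb : HolFun U b) :
    H.IsHeckeSection i U (fun y => ((ξ y).smulRight (e y), b y • dualPow n (ξ y))) where
  hol W hW hWU ℓ' ξ' hℓ' := by
    have hWU' : W ⊆ U := hWU.trans Set.sdiff_subset
    have h1 := hℓ.holFun hWU' hW hℓ'.1
    refine ⟨HolBundle.HolSection.smul h1 (he.mono hWU'), ?_⟩
    exact ((hb.mono hWU').mul (h1.pow n)).congr fun y _ => by simp
  pole x W _ hWU hxW := absurd x.2 (hU _ (hWU hxW))

variable [IsManifold 𝓘(ℂ) ω X]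

/-- The basic test section `(e, b) / z` near a point of `D`, for `z` the centred coordinate. It is a
section of the modification exactly because `(e x, b x)` lies in `Γ_x`. -/
lemma isHeckeSection_of_pole {x : H.D} (hxU : (x : X) ∈ U)
    (hUs : U ⊆ (chartAt ℂ (x : X)).source) (hUD : ∀ y ∈ U, y ∈ H.D → y = x)
    (hℓ : IsLineFrame L U ℓ ξ) (he : H.E.HolSection U e) (hb : HolFun U b)
    {w : H.NegPowFiber (x : X)} (hex : e x = -(i x w (ℓ x))) (hbx : b x = w fun _ => ℓ x) :
    H.IsHeckeSection i U (fun y => (chartAt ℂ (x : X) y - chartAt ℂ (x : X) x)⁻¹ •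
      ((ξ y).smulRight (e y), b y • dualPow n (ξ y))) where
  hol W hW hWU ℓ' ξ' hℓ' := by
    have hWU' : W ⊆ U := hWU.trans Set.sdiff_subset
    have h1 := hℓ.holFun hWU' hW hℓ'.1
    have hz : HolFun W (fun y => (chartAt ℂ (x : X) y - chartAt ℂ (x : X) x)⁻¹) :=
      ((holFun_chartAt_sub (x : X)).mono (hWU'.trans hUs)).inv fun y hy =>
        chartAt_sub_ne_zero (hUs (hWU' hy)) fun h => (hWU hy).2 (h ▸ x.2)
    refine ⟨HolBundle.HolSection.smul hz (HolBundle.HolSection.smul h1 (he.mono hWU')), ?_⟩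
    exact (hz.mul ((hb.mono hWU').mul (h1.pow n))).congr fun y _ => by simp
  pole x' W hW hWU hxW ℓ' ξ' hℓ' := by
    obtain rfl : x' = x := Subtype.ext (hUD _ (hWU hxW) x'.2)
    have h1 := hℓ.holFun hWU hW hℓ'.1
    have hx1 := hℓ.eq_smul hxU (ℓ' x')
    -- Passing to the frame `ℓ' = ξ(ℓ') ℓ` multiplies the first component by `ξ(ℓ')` and the second
    -- by its `n`-th power.
    refine ⟨W, hW, hxW, subset_rfl, hWU.trans hUs, fun y => ξ y (ℓ' y) • e y,
      fun y => b y * ξ y (ℓ' y) ^ n, w, HolBundle.HolSection.smul h1 (he.mono hWU),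
      (hb.mono hWU).mul (h1.pow n), ?_, ?_, fun y hy => ?_⟩
    · conv_rhs => rw [hx1]
      simp [hex]
    · conv_rhs => rw [hx1, MultilinearMap.map_smul_univ]
      simp [hbx, mul_comm]
    · have hz : chartAt ℂ (x' : X) y - chartAt ℂ (x' : X) x' ≠ 0 :=
        chartAt_sub_ne_zero (hUs (hWU hy.1)) fun h => hy.2 (h ▸ x'.2)
      constructor
      · simp [smul_smul, hz]
      · simp only [Prod.smul_mk, smul_apply, smul_eq_mul, dualPow_apply,
          Finset.prod_const, Finset.card_univ, Fintype.card_fin]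
        field_simp

/-- Off `D`, the pair `(f, c)` carries the Hecke modification of `i` into that of `i'`. -/
def CarriesHecke (H : SpHiggsBundle.{u, v, v₁} L n) (i i' : H.HeckeFamily)
    (f : ∀ x, Module.End ℂ (H.E.Fiber x)) (c : X → ℂ) : Prop :=
  ∀ U, IsOpen U → ∀ t, H.IsHeckeSection i U t → ∃ t', H.IsHeckeSection i' U t' ∧
    ∀ y ∈ U \ H.D, t' y = (f y ∘ₗ (t y).1, c y • (t y).2)

namespace CarriesHecke

variable {f : ∀ x, Module.End ℂ (H.E.Fiber x)} {c : X → ℂ} (hfc : H.CarriesHecke i i' f c)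

include hfc

omit [IsManifold 𝓘(ℂ) ω X] in
lemma hol_of_disjoint (hUo : IsOpen U) (hU : ∀ y ∈ U, y ∉ H.D) (hℓ : IsLineFrame L U ℓ ξ)
    (he : H.E.HolSection U e) (hb : HolFun U b) :
    H.E.HolSection U (fun y => f y (e y)) ∧ HolFun U (fun y => c y * b y) := by
  obtain ⟨t', ht', h⟩ := hfc U hUo _ (isHeckeSection_of_disjoint hU hℓ he hb)
  obtain ⟨h1, h2⟩ := ht'.hol U hUo (fun y hy => ⟨hy, hU y hy⟩) ℓ ξ hℓ
  refine ⟨h1.congr fun y hy => ?_, h2.congr fun y hy => ?_⟩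
  · simp [h y ⟨hy, hU y hy⟩, hℓ.2 y hy]
  · simp [h y ⟨hy, hU y hy⟩, hℓ.2 y hy]

/-- Transport `(e, b) / z` and clear the pole: `(f e, c b)` extends over `x`, with value in `Γ'_x`.
-/
lemma exists_at_pole {x : H.D} (hUo : IsOpen U) (hxU : (x : X) ∈ U)
    (hUs : U ⊆ (chartAt ℂ (x : X)).source) (hUD : ∀ y ∈ U, y ∈ H.D → y = x)
    (hℓ : IsLineFrame L U ℓ ξ) (he : H.E.HolSection U e) (hb : HolFun U b)
    {w : H.NegPowFiber (x : X)} (hex : e x = -(i x w (ℓ x))) (hbx : b x = w fun _ => ℓ x) :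
    ∃ W ⊆ U, IsOpen W ∧ (x : X) ∈ W ∧ ∃ (e' : ∀ y, H.E.Fiber y) (b' : X → ℂ)
      (w' : H.NegPowFiber (x : X)), H.E.HolSection W e' ∧ HolFun W b' ∧
      e' x = -(i' x w' (ℓ x)) ∧ (b' x = w' fun _ => ℓ x) ∧
      ∀ y ∈ W \ H.D, e' y = f y (e y) ∧ b' y = c y * b y := by
  obtain ⟨t', ht', h⟩ := hfc U hUo _ (isHeckeSection_of_pole hxU hUs hUD hℓ he hb hex hbx)
  obtain ⟨W, hW, hxW, hWU, hWs, e', b', w', he', hb', hex', hbx', hW'⟩ :=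
    ht'.pole x U hUo subset_rfl hxU ℓ ξ hℓ
  refine ⟨W, hWU, hW, hxW, e', b', w', he', hb', hex', hbx', fun y hy => ?_⟩
  have hz : chartAt ℂ (x : X) y - chartAt ℂ (x : X) x ≠ 0 :=
    chartAt_sub_ne_zero (hWs hy.1) fun h => hy.2 (h ▸ x.2)
  obtain ⟨h1, h2⟩ := hW' y hy
  rw [h y ⟨hWU hy.1, hy.2⟩] at h1 h2
  refine ⟨?_, ?_⟩
  · rw [h1]
    simp [hℓ.2 y (hWU hy.1), smul_smul, hz]
  · rw [h2]
    simp only [Prod.smul_mk, smul_apply, smul_eq_mul, dualPow_apply,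
      Finset.prod_const, Finset.card_univ, Fintype.card_fin, hℓ.2 y (hWU hy.1)]
    field_simp
    simp

end CarriesHecke

end SpHiggsBundle

end HeckeModifications

/-! ### From an isomorphism to a common sign. -/

section Forward

variable {X : Type u} [TopologicalSpace X] [ChartedSpace ℂ X] [IsManifold 𝓘(ℂ) ω X]

namespace SpHiggsBundle

variable {L : HolBundle.{u, v} X 1} {n : ℕ} {H : SpHiggsBundle.{u, v, v₁} L n}
  {i i' : H.HeckeFamily} {U : Set X} {ℓ : ∀ x, L.Fiber x}
  {ξ : ∀ x, Module.Dual ℂ (L.Fiber x)} {e : ∀ x, H.E.Fiber x}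
  {f : ∀ x, Module.End ℂ (H.E.Fiber x)} {c : X → ℂ}

namespace CarriesHecke

variable (hfc : H.CarriesHecke i i' f c) (hH : H.SmoothSpectralCurve)

include hfc hH

/-- Near `x ∈ D` write `(e, 0)` as `(z e, 0) / z`, with residue zero. Its image has zero second
component, so its residue in `Γ'_x` is zero as well and there is no pole: `f e` extends. -/
lemma exists_holSection_apply (hU : IsOpen U) {x : X} (hx : x ∈ U) (hℓ : IsLineFrame L U ℓ ξ)
    (he : H.E.HolSection U e) :
    ∃ W ⊆ U, IsOpen W ∧ x ∈ W ∧ ∃ e', H.E.HolSection W e' ∧ ∀ y ∈ W \ H.D, e' y = f y (e y) := by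
  obtain ⟨V, hV, hxV, hVD⟩ := exists_nhds_inter_D_subset hH x
  by_cases hxD : x ∈ H.D
  · let U₁ := U ∩ V ∩ (chartAt ℂ x).source
    have hU₁ : IsOpen U₁ := (hU.inter hV).inter (chartAt ℂ x).open_source
    have hxU₁ : x ∈ U₁ := ⟨⟨hx, hxV⟩, mem_chart_source ℂ x⟩
    have hU₁U : U₁ ⊆ U := fun y hy => hy.1.1
    have hU₁s : U₁ ⊆ (chartAt ℂ x).source := fun y hy => hy.2
    have hℓ₁ := hℓ.mono hU₁U
    obtain ⟨W, hWU, hW, hxW, e', b', w', he', hb', hex', hbx', h⟩ :=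
      hfc.exists_at_pole (x := ⟨x, hxD⟩) hU₁ hxU₁ hU₁s (fun y hy => hVD y hy.1.2) hℓ₁
        (HolBundle.HolSection.smul ((holFun_chartAt_sub x).mono hU₁s) (he.mono hU₁U))
        (HolFun.const 0) (w := 0) (by simp) (by simp)
    have hb0 : b' x = 0 := eq_of_eqOn_diff (g := fun _ => 0) (dense_compl_D hH) hW
      hb'.continuousOn continuousOn_const (fun y hy => by simpa using (h y hy).2) x hxW
    have hw0 : w' = 0 := multilinear_ext_of_line (L.finrank_fiber x) (hℓ.2 x hx)
      (by rw [← hbx', hb0]; simp)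
    have he0 : e' x = 0 := by rw [hex', hw0]; simp
    obtain ⟨W', hW'W, hW', hxW', hW's, t, ht, hte⟩ := he'.exists_eq_smul hW hxW he0
    refine ⟨W', (hW'W.trans hWU).trans hU₁U, hW', hxW', t, ht, fun y hy => ?_⟩
    have hz : chartAt ℂ x y - chartAt ℂ x x ≠ 0 :=
      chartAt_sub_ne_zero (hW's hy.1) fun h => hy.2 (h ▸ hxD)
    have h1 := (h y ⟨hW'W hy.1, hy.2⟩).1
    rw [hte y hy.1, map_smul] at h1
    exact smul_right_injective _ hz h1
  · refine ⟨U ∩ V, Set.inter_subset_left, hU.inter hV, ⟨hx, hxV⟩, _,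
      (hfc.hol_of_disjoint (hU.inter hV) (fun y hy hyD => hxD (hVD y hy.2 hyD ▸ hyD))
        (hℓ.mono Set.inter_subset_left) (he.mono Set.inter_subset_left) (HolFun.const 0)).1,
      fun y _ => rfl⟩

/-- The second component of a residue in `Γ_x` is arbitrary, so some section of the modification has
second component `1 / z` in the frame; its image `c / z` has at most a simple pole. -/
lemma exists_holFun_scalar (x : X) :
    ∃ W, IsOpen W ∧ x ∈ W ∧ ∃ h, HolFun W h ∧ ∀ y ∈ W \ H.D, h y = c y := by
  obtain ⟨U, hU, hxU, ℓ, ξ, hℓ⟩ := exists_isLineFrame L x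
  obtain ⟨V, hV, hxV, hVD⟩ := exists_nhds_inter_D_subset hH x
  by_cases hxD : x ∈ H.D
  · let w : H.NegPowFiber x := dualPow n (ξ x)
    obtain ⟨U', hU', hxU', e, he, hex⟩ :=
      H.E.exists_holSection_eq x (-(i ⟨x, hxD⟩ w (ℓ x)))
    let U₁ := U ∩ V ∩ (chartAt ℂ x).source ∩ U'
    have hU₁ : IsOpen U₁ := ((hU.inter hV).inter (chartAt ℂ x).open_source).inter hU'
    have hU₁U : U₁ ⊆ U := fun y hy => hy.1.1.1
    obtain ⟨W, hWU, hW, hxW, e', b', w', he', hb', hex', hbx', h⟩ :=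
      hfc.exists_at_pole (x := ⟨x, hxD⟩) hU₁ ⟨⟨⟨hxU, hxV⟩, mem_chart_source ℂ x⟩, hxU'⟩
        (fun y hy => hy.1.2) (fun y hy => hVD y hy.1.1.2) (hℓ.mono hU₁U)
        (he.mono fun y hy => hy.2) (HolFun.const 1) (w := w) hex (by simp [w, hℓ.2 x hxU])
    exact ⟨W, hW, hxW, b', hb', fun y hy => by simpa using (h y hy).2⟩
  · refine ⟨U ∩ V, hU.inter hV, ⟨hxU, hxV⟩, fun y => c y * 1,
      (hfc.hol_of_disjoint (hU.inter hV) (fun y hy hyD => hxD (hVD y hy.2 hyD ▸ hyD))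
        (hℓ.mono Set.inter_subset_left) (e := fun _ => 0) ?_ (HolFun.const 1)).2,
      fun y _ => by simp⟩
    obtain ⟨V', hV', hxV', s, hs⟩ := H.E.exists_holSection_eq x 0
    simpa using HolBundle.HolSection.sum (E := H.E) (U := U ∩ V) (S := (∅ : Finset ℕ))
      (F := fun _ _ => 0) (by simp)

/-- A vector cyclic at `x` extends to a section whose first `2n` iterates under `Φ` form a frame
nearby, and the `g k` are the coordinates of its image under `f`. Cyclicity over `D` is what makes
them holomorphic there. -/
lemma exists_coeff (hcomm : ∀ y ∉ H.D, ∀ η v,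
      f y (contract (H.Φ y) η v) = contract (H.Φ y) η (f y v))
    (hU : IsOpen U) {x : X} (hx : x ∈ U) (hℓ : IsLineFrame L U ℓ ξ) :
    ∃ W ⊆ U, IsOpen W ∧ x ∈ W ∧ ∃ g : Fin (2 * n) → X → ℂ, (∀ k, HolFun W (g k)) ∧
      ∀ y ∈ W \ H.D, f y = ∑ k, g k y • contract (H.Φ y) (ξ y) ^ (k : ℕ) := by
  obtain ⟨v, hv⟩ := exists_cyclic hH hU hℓ hx
  obtain ⟨U', hU', hxU', e, he, hex⟩ := H.E.exists_holSection_eq x v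
  have hUU' := hU.inter hU'
  have hℓ' := hℓ.mono (W := U ∩ U') Set.inter_subset_left
  have hpow : ∀ k : ℕ, H.E.HolSection (U ∩ U')
      (fun y => (contract (H.Φ y) (ξ y) ^ k) (e y)) := by
    intro k
    induction k with
    | zero => simpa using he.mono Set.inter_subset_right
    | succ k ih => simpa [pow_succ'] using H.Φ_hol _ hUU' ℓ ξ hℓ' _ ih
  obtain ⟨W₁, hW₁U, hW₁, hxW₁, κ, hκ⟩ := HolBundle.exists_isFrame_of_linearIndependent hUU'
    ⟨hx, hxU'⟩ (fun k : Fin (2 * n) => hpow k) (by simpa [hex] using hv)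
  obtain ⟨W₂, hW₂U, hW₂, hxW₂, e', he', hfe⟩ :=
    hfc.exists_holSection_apply hH hUU' ⟨hx, hxU'⟩ hℓ' (he.mono Set.inter_subset_right)
  refine ⟨W₁ ∩ W₂, fun y hy => (hW₁U hy.1).1, hW₁.inter hW₂, ⟨hxW₁, hxW₂⟩,
    fun k y => κ k y (e' y), fun k => ?_, fun y hy => ?_⟩
  · exact hκ.coord_hol _ Set.inter_subset_left (hW₁.inter hW₂) _
      (he'.mono Set.inter_subset_right) k
  · refine eq_sum_pow_of_commute (v := e y) (hcomm y hy.2 (ξ y)) ?_ ?_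
    · rw [← (hκ.basis hy.1.1).span_eq]
      refine Submodule.span_mono ?_
      rintro _ ⟨k, rfl⟩
      exact ⟨k, (hκ.basis_apply hy.1.1 k).symm⟩
    · rw [← hfe y ⟨hy.1.2, hy.2⟩]
      exact (hκ.sum_eq y hy.1.1 (e' y)).symm

end CarriesHecke

omit [IsManifold 𝓘(ℂ) ω X] in
lemma exists_zero_of_positiveDegree (hdeg : PositiveDegree L) :
    ∃ s, L.HolSection Set.univ s ∧ (∃ x, s x ≠ 0) ∧ ∃ x, s x = 0 := by
  obtain ⟨s, hs, hne, hpos⟩ := hdeg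
  refine ⟨s, hs, hne, ?_⟩
  by_contra! h
  have : ∀ x, vanishingOrder L s x = 0 := by
    intro x
    by_contra h0
    refine h x ?_
    have hx := FiberBundle.mem_baseSet_trivializationAt' (F := Fin 1 → ℂ) (E := L.Fiber) x
    have h1 := apply_eq_zero_of_analyticOrderNatAt_ne_zero h0
    rw [(chartAt ℂ x).left_inv (mem_chart_source ℂ x)] at h1
    let τ := (trivializationAt (Fin 1 → ℂ) L.Fiber x).continuousLinearEquivAt ℂ x hx
    have h2 : τ (s x) = 0 := by
      ext j
      rw [Subsingleton.elim j 0]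
      exact h1
    simpa using h2
  simp [this] at hpos

/-- If the section provided at `y` had no zero it would trivialise `L`, and every section would be a
constant multiple of it. This contradicts a non-zero section with a zero. -/
lemma exists_section_ne_zero_and_zero [CompactSpace X] [ConnectedSpace X] (hL : BasepointFree L)
    (hdeg : PositiveDegree L) (y : X) :
    ∃ s, L.HolSection Set.univ s ∧ s y ≠ 0 ∧ ∃ x, s x = 0 := by
  obtain ⟨s, hs, hsy⟩ := hL y
  by_cases h : ∃ x, s x = 0
  · exact ⟨s, hs, hsy, h⟩
  push Not at h
  obtain ⟨t, ht, ⟨x₁, hx₁⟩, x₀, hx₀⟩ := exists_zero_of_positiveDegree hdeg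
  have hdual : ∀ x, ∃ η : Module.Dual ℂ (L.Fiber x), η (s x) = 1 := fun x => by
    obtain ⟨U, -, hx, ℓ, ξ, hℓ⟩ := exists_isLineFrame L x
    have h0 : ξ x (s x) ≠ 0 := fun h0 => h x (by rw [hℓ.eq_smul hx (s x), h0, zero_smul])
    exact ⟨(ξ x (s x))⁻¹ • ξ x, by simp [h0]⟩
  choose η hη using hdual
  have hframe : IsLineFrame L Set.univ s η := ⟨hs, fun x _ => hη x⟩
  have hc := (hframe.holFun subset_rfl isOpen_univ ht).const_of_compact x₁ x₀
  rw [hx₀, map_zero] at hc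
  refine absurd ?_ hx₁
  rw [hframe.eq_smul (Set.mem_univ x₁) (t x₁), hc, zero_smul]

lemma CarriesHecke.exists_const [CompactSpace X] [ConnectedSpace X] (hL : BasepointFree L)
    (hdeg : PositiveDegree L) (hn : 1 ≤ n) (hH : H.SmoothSpectralCurve)
    (hfc : H.CarriesHecke i i' f c)
    (hcomm : ∀ y ∉ H.D, ∀ η v, f y (contract (H.Φ y) η v) = contract (H.Φ y) η (f y v)) :
    ∃ μ : ℂ, ∀ y ∉ H.D, ∀ v, f y v = μ • v := by
  -- `R k s y a` says that `a` is the coefficient of `Φ^k` in `f y`, an element of `L_y⁻ᵏ`, paired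
  -- with `s^k`; the frame used to compute it is left free.
  let R (k : Fin (2 * n)) (s : ∀ x, L.Fiber x) (y : X) (a : ℂ) : Prop :=
    ∃ (U : Set X) (ℓ : ∀ x, L.Fiber x) (ξ : ∀ x, Module.Dual ℂ (L.Fiber x)),
      IsOpen U ∧ y ∈ U ∧ IsLineFrame L U ℓ ξ ∧ ∃ g : Fin (2 * n) → ℂ,
        f y = ∑ k, g k • contract (H.Φ y) (ξ y) ^ (k : ℕ) ∧ a = g k * ξ y (s y) ^ (k : ℕ)
  have hfun : ∀ k s, ∀ y ∉ H.D, ∀ a b, R k s y a → R k s y b → a = b := by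
    rintro k s y - a b ⟨U, ℓ, ξ, hU, hy, hℓ, g, hg, rfl⟩ ⟨U', ℓ', ξ', hU', hy', hℓ', g', hg', rfl⟩
    have hξ : ξ' y = ξ' y (ℓ y) • ξ y := LinearMap.ext fun v => by
      conv_lhs => rw [hℓ.eq_smul hy v]
      simp [mul_comm]
    set r := ξ' y (ℓ y)
    obtain ⟨v, hv⟩ := exists_cyclic hH hU hℓ hy
    -- Coefficients on the powers of a regular endomorphism are unique, so they change with the
    -- frame as sections of `L⁻ʲ`.
    have hgg : ∀ j, g j = g' j * r ^ (j : ℕ) := by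
      rw [hg] at hg'
      have h1 := LinearMap.congr_fun hg' v
      simp only [hξ, contract_smul, smul_pow, LinearMap.sum_apply, LinearMap.smul_apply,
        smul_smul] at h1
      rw [← sub_eq_zero, ← Finset.sum_sub_distrib] at h1
      simp only [← sub_smul] at h1
      exact fun j => sub_eq_zero.mp (Fintype.linearIndependent_iff.mp hv _ h1 j)
    rw [hgg k, hξ, LinearMap.smul_apply, smul_eq_mul, mul_pow]
    ring
  have hgerm : ∀ k s, L.HolSection Set.univ s → ∀ x, ∃ W, IsOpen W ∧ x ∈ W ∧ ∃ h, HolFun W h ∧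
      (∀ y ∈ W \ H.D, R k s y (h y)) ∧ (s x = 0 → (k : ℕ) ≠ 0 → h x = 0) := by
    intro k s hs x
    obtain ⟨U, hU, hx, ℓ, ξ, hℓ⟩ := exists_isLineFrame L x
    obtain ⟨W, hWU, hW, hxW, g, hg, hfg⟩ := hfc.exists_coeff hH hcomm hU hx hℓ
    refine ⟨W, hW, hxW, fun y => g k y * ξ y (s y) ^ (k : ℕ), (hg k).mul
      ((hℓ.holFun hWU hW (hs.mono (Set.subset_univ _))).pow k), fun y hy => ?_, fun h0 hk => ?_⟩
    · exact ⟨U, ℓ, ξ, hU, hWU hy.1, hℓ, fun k => g k y, hfg y hy, rfl⟩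
    · simp [h0, hk]
  have hconst : ∀ k s, L.HolSection Set.univ s → ∃ C, ∀ W, IsOpen W → ∀ h, HolFun W h →
      (∀ y ∈ W \ H.D, R k s y (h y)) → ∀ x ∈ W, h x = C := fun k s hs =>
    exists_const_of_locally_holFun (dense_compl_D hH) (hfun k s) fun x => by
      obtain ⟨W, hW, hx, h, hh, hR, -⟩ := hgerm k s hs x
      exact ⟨W, hW, hx, h, hh, hR⟩
  have hval : ∀ k s, L.HolSection Set.univ s → ∃ C, (∀ y ∉ H.D, ∀ a, R k s y a → a = C) ∧
      ((k : ℕ) ≠ 0 → (∃ x, s x = 0) → C = 0) := by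
    intro k s hs
    obtain ⟨C, hC⟩ := hconst k s hs
    refine ⟨C, fun y hy a ha => ?_, ?_⟩
    · obtain ⟨W, hW, hyW, h, hh, hR, -⟩ := hgerm k s hs y
      rw [hfun k s y hy _ _ ha (hR y ⟨hyW, hy⟩)]
      exact hC W hW h hh hR y hyW
    · rintro hk ⟨x, hx⟩
      obtain ⟨W, hW, hxW, h, hh, hR, h0⟩ := hgerm k s hs x
      rw [← hC W hW h hh hR x hxW, h0 hx hk]
  -- For `k = 0` the pairing with `s^0` is trivial, so any global section will do.
  obtain ⟨s₀, hs₀, -⟩ := exists_zero_of_positiveDegree hdeg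
  let k₀ : Fin (2 * n) := ⟨0, by omega⟩
  obtain ⟨μ, hμ, -⟩ := hval k₀ s₀ hs₀
  refine ⟨μ, fun y hy v => ?_⟩
  obtain ⟨U, hU, hyU, ℓ, ξ, hℓ⟩ := exists_isLineFrame L y
  obtain ⟨W, hWU, hW, hyW, g, -, hfg⟩ := hfc.exists_coeff hH hcomm hU hyU hℓ
  have hfy := hfg y ⟨hyW, hy⟩
  have h0 : g k₀ y = μ := hμ y hy _ ⟨U, ℓ, ξ, hU, hyU, hℓ, fun k => g k y, hfy, by simp [k₀]⟩
  have hk : ∀ k, k ≠ k₀ → g k y = 0 := by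
    intro k hk
    have hk0 : (k : ℕ) ≠ 0 := fun h => hk (Fin.ext h)
    obtain ⟨s, hs, hsy, hzero⟩ := exists_section_ne_zero_and_zero hL hdeg y
    obtain ⟨C, hC, hC0⟩ := hval k s hs
    have h1 := hC y hy _ ⟨U, ℓ, ξ, hU, hyU, hℓ, fun k => g k y, hfy, rfl⟩
    rw [hC0 hk0 hzero] at h1
    refine (mul_eq_zero.mp h1).resolve_right (pow_ne_zero _ fun h2 => hsy ?_)
    rw [hℓ.eq_smul hyU (s y), h2, zero_smul]
  rw [hfy, Finset.sum_eq_single k₀ (fun k _ h => by rw [hk k h, zero_smul]) (by simp), h0]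
  simp [k₀]

lemma CarriesHecke.eq_or_eq_neg [CompactSpace X] [ConnectedSpace X] (hL : BasepointFree L)
    (hdeg : PositiveDegree L) (hn : 1 ≤ n) (hH : H.SmoothSpectralCurve) (hi : H.IsHeckeDatum i)
    (hi' : H.IsHeckeDatum i') (hfc : H.CarriesHecke i i' f c) (hc : ∀ y ∉ H.D, c y ≠ 0)
    (hcomm : ∀ y ∉ H.D, ∀ η v, f y (contract (H.Φ y) η v) = contract (H.Φ y) η (f y v)) :
    (∀ x : H.D, i x = i' x) ∨ (∀ x : H.D, i x = -i' x) := by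
  have hD := dense_compl_D hH
  obtain ⟨μ, hμ⟩ := hfc.exists_const hL hdeg hn hH hcomm
  obtain ⟨C, hC⟩ : ∃ C, ∀ y ∉ H.D, c y = C := by
    obtain ⟨C, hC⟩ := exists_const_of_locally_holFun hD (R := fun y a => a = c y)
      (fun y _ a b ha hb => ha.trans hb.symm) (hfc.exists_holFun_scalar hH)
    refine ⟨C, fun y hy => ?_⟩
    obtain ⟨W, hW, hyW, h, hh, hR⟩ := hfc.exists_holFun_scalar hH y
    rw [← hR y ⟨hyW, hy⟩]
    exact hC W hW h hh hR y hyW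
  have hC0 : C ≠ 0 := by
    obtain ⟨y, hy⟩ := hD.nonempty
    rw [← hC y hy]
    exact hc y hy
  -- Scaling by `(μ, C)` sends the residue `(-i w, w)` to `(-μ i w, C w)`, which must lie in `Γ'_x`.
  have key : ∀ x : H.D, C • i' x = μ • i x := by
    intro x
    refine LinearMap.ext fun w => ?_
    obtain ⟨U, hU, hxU, ℓ, ξ, hℓ⟩ := exists_isLineFrame L (x : X)
    obtain ⟨V, hV, hxV, hVD⟩ := exists_nhds_inter_D_subset hH (x : X)
    obtain ⟨U', hU', hxU', e, he, hex⟩ := H.E.exists_holSection_eq (x : X) (-(i x w (ℓ x)))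
    let U₁ := U ∩ V ∩ (chartAt ℂ (x : X)).source ∩ U'
    have hU₁ : IsOpen U₁ := ((hU.inter hV).inter (chartAt ℂ (x : X)).open_source).inter hU'
    have hU₁U : U₁ ⊆ U := fun y hy => hy.1.1.1
    obtain ⟨W, hWU, hW, hxW, e', b', w', he', hb', hex', hbx', h⟩ :=
      hfc.exists_at_pole (x := x) hU₁ ⟨⟨⟨hxU, hxV⟩, mem_chart_source ℂ (x : X)⟩, hxU'⟩
        (fun y hy => hy.1.2) (fun y hy => hVD y hy.1.1.2) (hℓ.mono hU₁U)
        (he.mono fun y hy => hy.2) (HolFun.const (w fun _ => ℓ x)) (w := w) hex rfl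
    have h1 : e' x = μ • e x := HolBundle.HolSection.eq_of_eqOn_diff hD hW he'
      (HolBundle.HolSection.smul (HolFun.const μ) (he.mono fun y hy => (hWU hy).2))
      (fun y hy => by rw [(h y hy).1, hμ y hy.2]) x hxW
    have h2 : b' x = C * w fun _ => ℓ x := eq_of_eqOn_diff (g := fun _ => C * w fun _ => ℓ x) hD hW
      hb'.continuousOn continuousOn_const (fun y hy => by rw [(h y hy).2, hC y hy.2]) x hxW
    have hw : w' = C • w := multilinear_ext_of_line (L.finrank_fiber (x : X)) (hℓ.2 x hxU)
      (by rw [← hbx', h2]; simp)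
    rw [hex', hw, hex, smul_neg, neg_inj, map_smul] at h1
    refine LinearMap.ext fun v => ?_
    rw [hℓ.eq_smul hxU v, map_smul, map_smul]
    congr 1
  have hκ : ∀ x, i' x = (μ / C) • i x := fun x => by
    rw [div_eq_inv_mul, mul_smul, ← key, smul_smul, inv_mul_cancel₀ hC0, one_smul]
  -- For empty `D` both alternatives hold vacuously; otherwise one point fixes the ratio.
  by_cases hne : Nonempty H.D
  swap
  · exact Or.inl fun x => absurd ⟨x⟩ hne
  obtain ⟨x⟩ := hne
  -- The left side of the normalisation scales by `(μ / C)²` from `i` to `i'`, while the right side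
  -- is the same and non-zero for `w(ℓ) = 1`.
  have hsq : (μ / C) ^ 2 = 1 := by
    obtain ⟨U, hU, hxU, ℓ, ξ, hℓ⟩ := exists_isLineFrame L (x : X)
    let w : H.NegPowFiber (x : X) := dualPow n (ξ x)
    have hw : (w fun _ => ℓ x) = 1 := by simp [w, hℓ.2 x hxU]
    obtain ⟨U', hU', hxU', e, he, hex⟩ := H.E.exists_holSection_eq (x : X) (i x w (ℓ x))
    have hU₁ := hU.inter hU'
    have hℓ₁ := hℓ.mono (W := U ∩ U') Set.inter_subset_left
    have he₁ := he.mono (W := U ∩ U') Set.inter_subset_right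
    have h1 := hi.normalized x w _ hU₁ ⟨hxU, hxU'⟩ ℓ ξ hℓ₁ e he₁ hex
    have h2 := hi'.normalized x w _ hU₁ ⟨hxU, hxU'⟩ ℓ ξ hℓ₁ (fun y => (μ / C) • e y)
      (HolBundle.HolSection.smul (HolFun.const _) he₁) (by simp [hex, hκ])
    have ha := deriv_a_ne_zero hH hU hℓ hxU x.2
    simp only [map_smul, LinearMap.smul_apply, smul_eq_mul, deriv_const_mul_field] at h1 h2
    rw [h1, hw] at h2
    have h3 : ((μ / C) ^ 2 - 1) * deriv (fun z : ℂ => H.a (2 * n) ((chartAt ℂ (x : X)).symm z)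
        (ξ ((chartAt ℂ (x : X)).symm z))) (chartAt ℂ (x : X) x) = 0 := by
      linear_combination -h2
    exact sub_eq_zero.mp ((mul_eq_zero.mp h3).resolve_right ha)
  rw [sq, mul_self_eq_one_iff] at hsq
  rcases hsq with h | h
  · exact Or.inl fun x => by rw [hκ, h, one_smul]
  · exact Or.inr fun x => by rw [hκ, h]; module

end SpHiggsBundle

end Forward

/-! ### Isomorphisms of Higgs bundles and maps of Hecke modifications. -/

section Isomorphisms

variable {X : Type u} [TopologicalSpace X] [ChartedSpace ℂ X]

namespace SpHiggsBundle

variable {L : HolBundle.{u, v} X 1} {n : ℕ} {H : SpHiggsBundle.{u, v, v₁} L n}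
  {i i' : H.HeckeFamily}

lemma exists_carriesHecke_of_iso {A : SOHiggsBundle.{u, v, v₂} L (2 * n + 1)}
    (hA : H.IsAssociated i A) {A' : SOHiggsBundle.{u, v, v₃} L (2 * n + 1)}
    (hA' : H.IsAssociated i' A') (Ψ : A.Iso A') :
    ∃ (f : ∀ x, Module.End ℂ (H.E.Fiber x)) (c : X → ℂ), H.CarriesHecke i i' f c ∧
      (∀ y ∉ H.D, c y ≠ 0) ∧
      ∀ y ∉ H.D, ∀ η v, f y (contract (H.Φ y) η v) = contract (H.Φ y) η (f y v) := by
  obtain ⟨T, hT, hTs, hTl, hTφ, -⟩ := hA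
  obtain ⟨T', hT', hTs', -, hTφ', -⟩ := hA'
  have hblocks : ∀ x, ∃ (f : Module.End ℂ (H.E.Fiber x)) (c : ℂ), x ∉ H.D → c ≠ 0 ∧
      (∀ η v, f (contract (H.Φ x) η v) = contract (H.Φ x) η (f v)) ∧
      ∀ v, T' x (Ψ.ψ x v) = (f ∘ₗ (T x v).1, c • (T x v).2) := by
    intro x
    by_cases hx : x ∈ H.D
    -- Over `D` the values are placeholders; only those off `D` matter.
    · exact ⟨0, 0, fun h => absurd hx h⟩
    let τ := LinearEquiv.ofBijective (T x) (hT x hx)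
    have hτ : ∀ t, T x (τ.symm t) = t := fun t => τ.apply_symm_apply t
    let F : H.ModelFiber x →ₗ[ℂ] H.ModelFiber x :=
      T' x ∘ₗ (Ψ.ψ x).toLinearMap ∘ₗ τ.symm.toLinearMap
    have hF : ∀ v, F (T x v) = T' x (Ψ.ψ x v) := fun v => by
      change T' x (Ψ.ψ x (τ.symm (τ v))) = _
      rw [τ.symm_apply_apply]
    obtain ⟨f, c, hc, hf, hFf⟩ := exists_blocks_of_bijective hx F
      ((hT' x hx).1.comp ((Ψ.ψ x).injective.comp τ.symm.injective)) fun ξ t => by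
        obtain ⟨v, rfl⟩ := (hT x hx).2 t
        rw [hF, ← hTφ x hx, hF, ← hTφ' x hx]
        exact congrArg (T' x) (contract_comm (ψ := (Ψ.ψ x).toLinearMap) (Ψ.comm x v) ξ).symm
    exact ⟨f, c, fun _ => ⟨hc, hf, fun v => by rw [← hF, hFf]⟩⟩
  choose f c hfc using hblocks
  refine ⟨f, c, fun U hU t ht => ?_, fun y hy => (hfc y hy).1, fun y hy => (hfc y hy).2.1⟩
  obtain ⟨s, hs, hst⟩ := hTl U hU t ht
  refine ⟨_, hTs' U hU _ (Ψ.ψ_hol U hU s hs), fun y hy => ?_⟩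
  rw [← hst y hy]
  exact (hfc y hy.2).2.2 (s y)

/-- Multiplication by `κ` on the first summand takes `(-i w, w)` to `(-κ i w, w)`, that is, `Γ_x`
into `Γ'_x`. -/
lemma IsHeckeSection.smul_fst {U : Set X} {t : ∀ x, H.ModelFiber x} (ht : H.IsHeckeSection i U t)
    {κ : ℂ} (hκ : ∀ x, i' x = κ • i x) :
    H.IsHeckeSection i' U (fun y => (κ • (t y).1, (t y).2)) where
  hol W hW hWU ℓ ξ hℓ := by
    obtain ⟨h1, h2⟩ := ht.hol W hW hWU ℓ ξ hℓ
    exact ⟨HolBundle.HolSection.smul (HolFun.const κ) h1, h2⟩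
  pole x W hW hWU hxW ℓ ξ hℓ := by
    obtain ⟨W', hW', hxW', hW'W, hW's, e, b, w, he, hb, hex, hbx, h⟩ :=
      ht.pole x W hW hWU hxW ℓ ξ hℓ
    refine ⟨W', hW', hxW', hW'W, hW's, fun y => κ • e y, b, w,
      HolBundle.HolSection.smul (HolFun.const κ) he, hb, by simp [hex, hκ], hbx, fun y hy => ?_⟩
    exact ⟨by simp only [(h y hy).1]; exact smul_comm _ _ _, (h y hy).2⟩

variable [IsManifold 𝓘(ℂ) ω X]

/-- Over `D` the fibres of `V'` cannot be read off from `T'`. The map is therefore built from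
sheaves: lift the images of a local frame to sections of `V'` and extend linearly. -/
lemma exists_holHom {m m' : ℕ} {V : HolBundle.{u, v₂} X m} {V' : HolBundle.{u, v₃} X m'}
    (hH : H.SmoothSpectralCurve) {κ : ℂ} (hκ : ∀ x, i' x = κ • i x)
    {T : ∀ x, V.Fiber x →ₗ[ℂ] H.ModelFiber x} {T' : ∀ x, V'.Fiber x →ₗ[ℂ] H.ModelFiber x}
    (hT : ∀ U : Set X, IsOpen U → ∀ s, V.HolSection U s →
      H.IsHeckeSection i U (fun x => T x (s x)))
    (hT' : ∀ x ∉ H.D, Function.Injective (T' x))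
    (hTl' : ∀ U : Set X, IsOpen U → ∀ t, H.IsHeckeSection i' U t →
      ∃ s, V'.HolSection U s ∧ ∀ x ∈ U \ H.D, T' x (s x) = t x) :
    ∃ ψ : ∀ x, V.Fiber x →ₗ[ℂ] V'.Fiber x, HolHom V V' ψ ∧
      ∀ x ∉ H.D, ∀ v, T' x (ψ x v) = (κ • (T x v).1, (T x v).2) := by
  have hlocal : ∀ x, ∃ (W : Set X) (s : Fin m → ∀ y, V.Fiber y)
      (σ : Fin m → ∀ y, Module.Dual ℂ (V.Fiber y)) (s' : Fin m → ∀ y, V'.Fiber y),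
      IsOpen W ∧ x ∈ W ∧ (∀ y ∈ W, y ∈ H.D → y = x) ∧ V.IsFrame W s σ ∧
      (∀ j, V'.HolSection W (s' j)) ∧
      ∀ j, ∀ y ∈ W \ H.D, T' y (s' j y) = (κ • (T y (s j y)).1, (T y (s j y)).2) := by
    intro x
    obtain ⟨U, hU, hxU, s, σ, hs⟩ := V.exists_isFrame x
    obtain ⟨W, hW, hxW, hWD⟩ := exists_nhds_inter_D_subset hH x
    have hUW := hU.inter hW
    have hs' := hs.mono (W := U ∩ W) Set.inter_subset_left
    choose s' hs'h hs'T using fun j => hTl' _ hUW _ ((hT _ hUW _ (hs'.hol j)).smul_fst hκ)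
    exact ⟨U ∩ W, s, σ, s', hUW, ⟨hxU, hxW⟩, fun y hy => hWD y hy.2, hs', hs'h, hs'T⟩
  choose W s σ s' hW hxW hWD hs hs' hTs using hlocal
  have hTsum : ∀ x, ∀ y ∈ W x, y ∉ H.D → ∀ v,
      T' y (∑ j, σ x j y v • s' x j y) = (κ • (T y v).1, (T y v).2) := by
    intro x y hy hyD v
    conv_rhs => rw [← (hs x).sum_eq y hy v]
    simp only [map_sum, map_smul, hTs x _ y ⟨hy, hyD⟩, Prod.fst_sum, Prod.snd_sum, Prod.smul_fst,
      Prod.smul_snd, Finset.smul_sum]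
    refine Prod.ext ?_ ?_
    · simp only [Prod.fst_sum, Prod.smul_fst]
      exact Finset.sum_congr rfl fun j _ => smul_comm _ _ _
    · simp only [Prod.snd_sum, Prod.smul_snd]
  let ψ : ∀ x, V.Fiber x →ₗ[ℂ] V'.Fiber x := fun x => ∑ j, (σ x j x).smulRight (s' x j x)
  have hψ : ∀ x v, ψ x v = ∑ j, σ x j x v • s' x j x := fun x v => by
    simp [ψ]
  have hTψ : ∀ x ∉ H.D, ∀ v, T' x (ψ x v) = (κ • (T x v).1, (T x v).2) := fun x hx v => by
    rw [hψ, hTsum x x (hxW x) hx]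
  refine ⟨ψ, fun U hU t ht => HolBundle.HolSection.of_locally fun x hx => ?_, hTψ⟩
  refine ⟨W x, hW x, hxW x, ?_⟩
  refine (HolBundle.HolSection.sum (S := Finset.univ) fun j _ => HolBundle.HolSection.smul
    ((hs x).coord_hol _ Set.inter_subset_right (hU.inter (hW x)) t
      (ht.mono Set.inter_subset_left) j)
    ((hs' x j).mono Set.inter_subset_right)).congr fun y hy => ?_
  -- The map is defined at each point by that point's own frame. The choices agree: off `D` by
  -- injectivity of `T'`, and a point of `D` in `W x` can only be `x` itself.
  by_cases hyD : y ∈ H.D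
  · obtain rfl := hWD x y hy.2 hyD
    exact hψ y _
  · exact hT' y hyD (by rw [hTψ y hyD, hTsum x y hy.2 hyD])

lemma leftInverse_of_compl_D {m m' : ℕ} {V : HolBundle.{u, v₂} X m} {V' : HolBundle.{u, v₃} X m'}
    (hH : H.SmoothSpectralCurve) {ψ : ∀ x, V.Fiber x →ₗ[ℂ] V'.Fiber x}
    {ψ' : ∀ x, V'.Fiber x →ₗ[ℂ] V.Fiber x} (hψ : HolHom V V' ψ) (hψ' : HolHom V' V ψ')
    (h : ∀ x ∉ H.D, ∀ v, ψ' x (ψ x v) = v) (x : X) (v : V.Fiber x) : ψ' x (ψ x v) = v := by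
  obtain ⟨U, hU, hx, s, hs, rfl⟩ := V.exists_holSection_eq x v
  exact HolBundle.HolSection.eq_of_eqOn_diff (dense_compl_D hH) hU
    (hψ' U hU _ (hψ U hU s hs)) hs (fun y hy => h y hy.2 _) x hx

lemma nonempty_iso_of_eq_smul (hH : H.SmoothSpectralCurve) {κ : ℂ} (hκ2 : κ * κ = 1)
    (hκ : ∀ x, i' x = κ • i x) {A : SOHiggsBundle.{u, v, v₂} L (2 * n + 1)}
    (hA : H.IsAssociated i A) {A' : SOHiggsBundle.{u, v, v₃} L (2 * n + 1)}
    (hA' : H.IsAssociated i' A') : Nonempty (A.Iso A') := by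
  have hD := dense_compl_D hH
  have hκ' : ∀ x, i x = κ • i' x := fun x => by rw [hκ, smul_smul, hκ2, one_smul]
  obtain ⟨T, hT, hTs, hTl, hTφ, hTQ⟩ := hA
  obtain ⟨T', hT', hTs', hTl', hTφ', hTQ'⟩ := hA'
  obtain ⟨ψ, hψ, hTψ⟩ := exists_holHom hH hκ hTs (fun x hx => (hT' x hx).1) hTl'
  obtain ⟨ψ', hψ', hTψ'⟩ := exists_holHom hH hκ' hTs' (fun x hx => (hT x hx).1) hTl
  have hinv : ∀ x v, ψ' x (ψ x v) = v := leftInverse_of_compl_D hH hψ hψ' fun x hx v =>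
    (hT x hx).1 (by rw [hTψ' x hx, hTψ x hx, smul_smul, hκ2, one_smul])
  have hinv' : ∀ x v, ψ x (ψ' x v) = v := leftInverse_of_compl_D hH hψ' hψ fun x hx v =>
    (hT' x hx).1 (by rw [hTψ x hx, hTψ' x hx, smul_smul, hκ2, one_smul])
  let Ψ : ∀ x, A.V.Fiber x ≃ₗ[ℂ] A'.V.Fiber x := fun x =>
    LinearEquiv.ofLinearMap (ψ x) (ψ' x) (LinearMap.ext (hinv' x)) (LinearMap.ext (hinv x))
  have hcommD : ∀ x ∉ H.D, ∀ η v,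
      contract (A'.φ x) η (ψ x v) = ψ x (contract (A.φ x) η v) := fun x hx η v =>
    (hT' x hx).1 (by
      rw [hTφ' x hx, hTψ x hx, hTψ x hx, hTφ x hx]
      simp only [LinearMap.comp_smul])
  have hQD : ∀ x ∉ H.D, ∀ v, A'.Q x (ψ x v) (ψ x v) = A.Q x v v := fun x hx v => by
    obtain ⟨U, hU, hxU, ℓ, ξ, hℓ⟩ := exists_isLineFrame L x
    rw [hTQ' x hx (ℓ x) (ξ x) (hℓ.2 x hxU), hTQ x hx (ℓ x) (ξ x) (hℓ.2 x hxU), hTψ x hx]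
    simp only [LinearMap.smul_apply, map_smul, smul_smul, hκ2, one_smul]
  -- Polarisation: the association prescribes only the quadratic form.
  have hQD2 : ∀ x ∉ H.D, ∀ v w, A'.Q x (ψ x v) (ψ x w) = A.Q x v w := fun x hx v w => by
    have h1 := hQD x hx (v + w)
    simp only [map_add, LinearMap.add_apply, hQD x hx, A'.Q_symm x (ψ x w) (ψ x v),
      A.Q_symm x w v] at h1
    linear_combination h1 / 2
  refine ⟨⟨Ψ, hψ, hψ', fun x v => ?_, fun x v w => ?_⟩⟩
  · obtain ⟨U, hU, hxU, ℓ, ξ, hℓ⟩ := exists_isLineFrame L x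
    obtain ⟨U', hU', hxU', s, hs, rfl⟩ := A.V.exists_holSection_eq x v
    have hUU' := hU.inter hU'
    have hℓ' := hℓ.mono (W := U ∩ U') Set.inter_subset_left
    have hs' := hs.mono (W := U ∩ U') Set.inter_subset_right
    refine lTensor_of_contract_comm (L.finrank_fiber x) (hℓ.2 x hxU) ?_
    exact HolBundle.HolSection.eq_of_eqOn_diff hD hUU'
      (A'.φ_hol _ hUU' ℓ ξ hℓ' _ (hψ _ hUU' s hs')) (hψ _ hUU' _ (A.φ_hol _ hUU' ℓ ξ hℓ' s hs'))
      (fun y hy => hcommD y hy.2 _ _) x ⟨hxU, hxU'⟩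
  · obtain ⟨U, hU, hxU, s, hs, rfl⟩ := A.V.exists_holSection_eq x v
    obtain ⟨U', hU', hxU', t, ht, rfl⟩ := A.V.exists_holSection_eq x w
    have hUU' := hU.inter hU'
    have hs' := hs.mono (W := U ∩ U') Set.inter_subset_left
    have ht' := ht.mono (W := U ∩ U') Set.inter_subset_right
    exact eq_of_eqOn_diff hD hUU'
      (A'.Q_hol _ hUU' _ _ (hψ _ hUU' s hs') (hψ _ hUU' t ht')).continuousOn
      (A.Q_hol _ hUU' s t hs' ht').continuousOn
      (fun y hy => hQD2 y hy.2 _ _) x ⟨hxU, hxU'⟩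

end SpHiggsBundle

end Isomorphisms

theorem mainTheorem7
    {X : Type u} [TopologicalSpace X] [T2Space X] [CompactSpace X] [ConnectedSpace X]
    [ChartedSpace ℂ X] [IsManifold 𝓘(ℂ) ω X]
    (L : HolBundle.{u, v} X 1) (hL : BasepointFree L) (hdeg : PositiveDegree L)
    (n : ℕ) (hn : 1 ≤ n)
    (H : SpHiggsBundle.{u, v, v₁} L n) (hH : H.IsGeneric)
    (i i' : H.HeckeFamily) (hi : H.IsHeckeDatum i) (hi' : H.IsHeckeDatum i')
    (A : SOHiggsBundle.{u, v, v₂} L (2 * n + 1)) (hA : H.IsAssociated i A)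
    (A' : SOHiggsBundle.{u, v, v₃} L (2 * n + 1)) (hA' : H.IsAssociated i' A') :
    Nonempty (A.Iso A') ↔ ((∀ x : H.D, i x = i' x) ∨ (∀ x : H.D, i x = -i' x)) := by
  refine ⟨fun ⟨Ψ⟩ => ?_, fun h => ?_⟩
  · obtain ⟨f, c, hfc, hc, hcomm⟩ := SpHiggsBundle.exists_carriesHecke_of_iso hA hA' Ψ
    exact hfc.eq_or_eq_neg hL hdeg hn hH.smooth hi hi' hc hcomm
  · rcases h with h | h
    · exact SpHiggsBundle.nonempty_iso_of_eq_smul hH.smooth (κ := 1) (by norm_num)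
        (fun x => by rw [h x, one_smul]) hA hA'
    · exact SpHiggsBundle.nonempty_iso_of_eq_smul hH.smooth (κ := -1) (by norm_num)
        (fun x => by rw [h x]; module) hA hA'
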